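/- Let $M$ be a (smooth, Hausdorff, second countable) supermanifold of dimension $n|m$ with $n-m\neq -1,-3$. Write $\tilde\imath\in\{0,1\}$ for the parity of the local coordinate $x^i$ and $\tilde f$ for the parity of a function $f$, and sum over repeated indices; $\partial_i$ denotes the left partial derivative. Let $M$ be equipped with a projective class, that is, an equivalence class of symmetric linear connections ($\nabla_{\partial_i}\partial_j=\Gamma^k_{ij}\partial_k$), two connections being equivalent if in all local coordinates they have the same $$\Pi^k_{ji}=\Gamma^k_{ji}-\frac1{n-m+1}\left(\Gamma^s_{js}\delta^k_i(-1)^{\tilde s}+\Gamma^s_{is}\delta^k_j(-1)^{\tilde\imath\tilde\jmath+\tilde s}\right).$$ Let $S=S^{ij}p_jp_i$ be an odd quadratic Hamiltonian on $T^*M$, with $S^{ij}=(-1)^{\tilde\imath\tilde\jmath}S^{ji}$, and suppose that $$[f,g]=(-1)^{\tilde f}((S,f),g)=(-1)^{\tilde f}\,2S^{ij}(-1)^{\tilde\imath\tilde f}\,\partial_jf\,\partial_ig,$$ where $(\cdot,\cdot)$ is the canonical even Poisson bracket on $T^*M$ with $(p_i,x^j)=\delta_i^j$, is an odd Poisson bracket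 on $C^\infty(M)$. Let $\Delta$ be the projective Laplacian on $C^\infty(M)$, given in local coordinates by $$\Delta=S^{ij}\partial_j\partial_i+T^i\partial_i,\qquad T^i=\frac{2}{n-m+3}\,\partial_jS^{ji}-\frac{n-m+1}{n-m+3}\,S^{jk}\Pi^i_{kj}.$$ Then $\Delta$ is a Batalin-Vilkovisky operator for $[\cdot,\cdot]$, that is, $[f,g]=(-1)^{\tilde f}\left(\Delta(fg)-\Delta(f)g-(-1)^{\tilde f}f\Delta(g)\right)$ and $\Delta^2=0$, if and only if in the local coordinates of every chart of an atlas of $M$, for all $i,j$, $$S^{jk}\partial_k\partial_jT^i+T^j\partial_jT^i=0,$$ $$S^{kl}\partial_l\partial_kS^{ij}+T^k\partial_kS^{ij}+(-1)^{\tilde\imath}S^{ik}\partial_kT^j+(-1)^{\tilde\jmath(\tilde\imath+1)}S^{jk}\partial_kT^i=0.$$ -/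

import Mathlib

open CategoryTheory TopologicalSpace Opposite
open scoped ContDiff

universe u

noncomputable section

namespace SuperGeom

/-- Coordinate indices in dimension `n|m`: the even ones, then the odd ones. -/
abbrev Idx (n m : ℕ) : Type := Fin n ⊕ Fin m

/-- The parity of a coordinate index. -/
def par {n m : ℕ} : Idx n m → ZMod 2 := Sum.elim (fun _ => 0) (fun _ => 1)

/-- The sign `(-1)^a` for `a` in `ℤ/2`. -/
def sgn (a : ZMod 2) : ℝ := if a = 0 then 1 else -1

/-! ### The local model: smooth functions with values in a Grassmann algebra -/

/-- The Grassmann algebra on `ξ¹, …, ξᵐ`; `A I` is the coefficient of the monomial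
`ξ^I = ξ^{i₁} ⋯ ξ^{iₖ}`, where `I = {i₁ < ⋯ < iₖ}`. -/
abbrev Grassmann (m : ℕ) : Type := Finset (Fin m) → ℝ

/-- The product of the Grassmann algebra: `ξ^I ξ^J = 0` if `I` and `J` meet, and otherwise
`ξ^I ξ^J = (-1)^r ξ^(I ∪ J)`, with `r` the number of pairs `(a, b) ∈ I × J` with `b < a`. -/
def Grassmann.mul {m : ℕ} (A B : Grassmann m) : Grassmann m := fun K =>
  ∑ I ∈ K.powerset,
    (-1 : ℝ) ^ ((I ×ˢ (K \ I)).filter (fun q => q.2 < q.1)).card * A I * B (K \ I)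

/-- The unit of the Grassmann algebra. -/
def Grassmann.one {m : ℕ} : Grassmann m := fun I => if I = ∅ then 1 else 0

/-- Superfunctions `∑_I F_I(x) ξ^I` on the superdomain of dimension `n|m` over `V ⊆ ℝⁿ`, with
coefficients smooth on `V`. A function on `V` is represented by its extension by zero. -/
def SuperFun (n m : ℕ) (V : Opens (EuclideanSpace ℝ (Fin n))) :
    Submodule ℝ (EuclideanSpace ℝ (Fin n) → Grassmann m) where
  carrier := {F | (∀ I, ContDiffOn ℝ ∞ (fun x => F x I) V) ∧ ∀ x, x ∉ V → F x = 0}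
  add_mem' := fun {F G} hF hG =>
    ⟨fun I => (hF.1 I).add (hG.1 I), fun x hx => by simp [hF.2 x hx, hG.2 x hx]⟩
  zero_mem' := ⟨fun _ => contDiffOn_const, fun _ _ => rfl⟩
  smul_mem' := fun r F hF =>
    ⟨fun I => contDiffOn_const.mul (hF.1 I), fun x hx => by simp [hF.2 x hx]⟩

open Classical in
/-- The (left) partial derivatives of superfunctions, `∂/∂xⁱ` and `∂/∂ξʲ`. -/
def SuperFun.pd {n m : ℕ} {V : Opens (EuclideanSpace ℝ (Fin n))} :
    Idx n m → SuperFun n m V → SuperFun n m V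
  | Sum.inl i, F =>
    ⟨fun x I => if x ∈ V then fderiv ℝ (fun y => F.1 y I) x (EuclideanSpace.single i 1) else 0, by
      refine ⟨fun I => ?_, fun x hx => by funext I; simp [hx]⟩
      have h : ContDiffOn ℝ ∞ (fun x => fderiv ℝ (fun y => F.1 y I) x
          (EuclideanSpace.single i 1)) V :=
        ((F.2.1 I).fderiv_of_isOpen V.isOpen (by simp)).clm_apply contDiffOn_const
      exact h.congr fun x hx => if_pos hx⟩
  | Sum.inr j, F =>
    ⟨fun x I => if j ∈ I then 0 else
        (-1 : ℝ) ^ (I.filter (fun k => k < j)).card * F.1 x (insert j I), by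
      refine ⟨fun I => ?_, fun x hx => by funext I; simp [F.2.2 x hx]⟩
      by_cases hj : j ∈ I
      · simpa [hj] using contDiffOn_const
      · simpa [hj] using contDiffOn_const.mul (F.2.1 (insert j I))⟩

open Classical in
/-- The coordinates `xⁱ` and `ξʲ` as superfunctions. -/
def SuperFun.coord {n m : ℕ} {V : Opens (EuclideanSpace ℝ (Fin n))} :
    Idx n m → SuperFun n m V
  | Sum.inl i =>
    ⟨fun x I => if x ∈ V ∧ I = ∅ then x i else 0, by
      refine ⟨fun I => ?_, fun x hx => by funext I; simp [hx]⟩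
      by_cases hI : I = ∅
      · have h : ContDiffOn ℝ ∞ (fun x : EuclideanSpace ℝ (Fin n) => x i) V := by fun_prop
        exact h.congr fun x hx => if_pos ⟨hx, hI⟩
      · simpa [hI] using contDiffOn_const⟩
  | Sum.inr j =>
    ⟨fun x I => if x ∈ V ∧ I = {j} then 1 else 0, by
      refine ⟨fun I => ?_, fun x hx => by funext I; simp [hx]⟩
      by_cases hI : I = {j}
      · have h : ContDiffOn ℝ ∞ (fun _ : EuclideanSpace ℝ (Fin n) => (1 : ℝ)) V :=
          contDiffOn_const
        exact h.congr fun x hx => if_pos ⟨hx, hI⟩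
      · simpa [hI] using contDiffOn_const⟩

/-! ### Supermanifolds -/

/-- A topological space with a sheaf of supercommutative real superalgebras. -/
structure SuperSpace where
  carrier : TopCat.{u}
  sheaf : TopCat.Sheaf (AlgCat.{u} ℝ) carrier
  /-- The even (`0`) and odd (`1`) sections. -/
  gr : ∀ U : Opens carrier, ZMod 2 → Submodule ℝ (sheaf.1.obj (op U))
  isInternal : ∀ U, DirectSum.IsInternal (gr U)
  gradedMonoid : ∀ U, SetLike.GradedMonoid (gr U)
  res_mem : ∀ {U V : Opens carrier} (h : V ≤ U) (a : ZMod 2) (f : sheaf.1.obj (op U)),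
    f ∈ gr U a → (sheaf.1.map (homOfLE h).op).hom f ∈ gr V a
  supercomm : ∀ (U : Opens carrier) (a b : ZMod 2) (f g : sheaf.1.obj (op U)),
    f ∈ gr U a → g ∈ gr U b → f * g = sgn (a * b) • (g * f)

/-- The superalgebra of sections over `U`. -/
abbrev SuperSpace.Sec (X : SuperSpace.{u}) (U : Opens X.carrier) : AlgCat.{u} ℝ :=
  X.sheaf.1.obj (op U)

/-- Restriction of sections. -/
def SuperSpace.res (X : SuperSpace.{u}) {U V : Opens X.carrier} (h : V ≤ U) :
    X.Sec U →ₐ[ℝ] X.Sec V :=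
  (X.sheaf.1.map (homOfLE h).op).hom

/-- The open subset of `ℝⁿ` onto which a chart maps an open subset of its domain. -/
def imageOpens {n : ℕ} {X : TopCat.{u}} (e : OpenPartialHomeomorph X (EuclideanSpace ℝ (Fin n)))
    (W : Opens X) (h : (W : Set X) ⊆ e.source) : Opens (EuclideanSpace ℝ (Fin n)) :=
  ⟨e '' W, e.isOpen_image_of_subset_source W.isOpen h⟩

/-- A chart of dimension `n|m`: an isomorphism of the restriction of the structure sheaf to an open
subset with the sheaf of superfunctions on a superdomain. -/
structure SuperChart (X : SuperSpace.{u}) (n m : ℕ) where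
  body : OpenPartialHomeomorph X.carrier (EuclideanSpace ℝ (Fin n))
  iso : ∀ (W : Opens X.carrier) (h : (W : Set X.carrier) ⊆ body.source),
    X.Sec W ≃ₗ[ℝ] SuperFun n m (imageOpens body W h)
  iso_one : ∀ W h, ∀ x ∈ imageOpens body W h, (iso W h 1).1 x = Grassmann.one
  iso_mul : ∀ W h f g x, (iso W h (f * g)).1 x = Grassmann.mul ((iso W h f).1 x) ((iso W h g).1 x)
  iso_parity : ∀ W h a f,
    f ∈ X.gr W a ↔ ∀ x I, (I.card : ZMod 2) ≠ a → (iso W h f).1 x I = 0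
  iso_res : ∀ (W W' : Opens X.carrier) (h : (W : Set X.carrier) ⊆ body.source) (hW : W' ≤ W)
    (f : X.Sec W), ∀ x ∈ imageOpens body W' (Set.Subset.trans hW h),
      (iso W' (Set.Subset.trans hW h) (X.res hW f)).1 x = (iso W h f).1 x

namespace SuperChart

variable {X : SuperSpace.{u}} {n m : ℕ}

/-- The domain of a chart. -/
def dom (c : SuperChart X n m) : Opens X.carrier := ⟨c.body.source, c.body.open_source⟩

/-- The partial derivative with respect to a coordinate of the chart, on sections over an open
subset `W` of its domain. -/
def pd (c : SuperChart X n m) {W : Opens X.carrier} (h : W ≤ c.dom) (i : Idx n m)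
    (f : X.Sec W) : X.Sec W :=
  (c.iso W h).symm (SuperFun.pd i (c.iso W h f))

/-- The coordinates of the chart, as sections over an open subset `W` of its domain. -/
def coord (c : SuperChart X n m) {W : Opens X.carrier} (h : W ≤ c.dom) (i : Idx n m) : X.Sec W :=
  (c.iso W h).symm (SuperFun.coord i)

/-- The partial derivative on the whole domain of the chart. -/
def D (c : SuperChart X n m) (i : Idx n m) (f : X.Sec c.dom) : X.Sec c.dom :=
  c.pd le_rfl i f

/-- The Jacobian entry `∂y^a/∂x^i` on the common domain of two charts with coordinates
`x` (of `c`) and `y` (of `d`). -/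
def jac (c d : SuperChart X n m) (i a : Idx n m) : X.Sec (c.dom ⊓ d.dom) :=
  c.pd inf_le_left i (d.coord inf_le_right a)

end SuperChart

/-- A supermanifold of dimension `n|m`, with an atlas (which may be the maximal one). -/
structure Supermanifold (n m : ℕ) extends SuperSpace.{u} where
  t2 : T2Space carrier
  secondCountable : SecondCountableTopology carrier
  ι : Type u
  chart : ι → SuperChart toSuperSpace n m
  cover : ∀ p : carrier, ∃ c, p ∈ (chart c).dom

namespace Supermanifold

variable {n m : ℕ}

/-- The superalgebra `C^∞(M)` of global functions. -/
abbrev Fun (M : Supermanifold.{u} n m) : AlgCat.{u} ℝ := M.Sec ⊤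

/-- The superalgebra of functions on the domain of a chart. -/
abbrev Loc (M : Supermanifold.{u} n m) (c : M.ι) : AlgCat.{u} ℝ := M.Sec (M.chart c).dom

/-- The restriction of a global function to the domain of a chart. -/
def toLoc (M : Supermanifold.{u} n m) (c : M.ι) : M.Fun →ₐ[ℝ] M.Loc c := M.res le_top

/-- Restriction from the first chart domain to the overlap of two chart domains. -/
def resL (M : Supermanifold.{u} n m) (c d : M.ι) :
    M.Loc c →ₐ[ℝ] M.Sec ((M.chart c).dom ⊓ (M.chart d).dom) := M.res inf_le_left

/-- Restriction from the second chart domain to the overlap of two chart domains. -/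
def resR (M : Supermanifold.{u} n m) (c d : M.ι) :
    M.Loc d →ₐ[ℝ] M.Sec ((M.chart c).dom ⊓ (M.chart d).dom) := M.res inf_le_right

end Supermanifold

/-! ### Tensor fields, connections and projective classes -/

/-- An odd (super)symmetric contravariant tensor field `S^{ij}` of rank two, that is, an odd
Hamiltonian `S^{ij} p_j p_i` on the cotangent bundle, by its components in the charts. The
transformation law is that of `S^{ij} p_j p_i` under `p_i = (∂y^a/∂x^i) p_a`. -/
structure OddTensor {n m : ℕ} (M : Supermanifold.{u} n m) where
  comp : ∀ c : M.ι, Idx n m → Idx n m → M.Loc c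
  parity : ∀ c i j, comp c i j ∈ M.gr _ (par i + par j + 1)
  symm : ∀ c i j, comp c i j = sgn (par i * par j) • comp c j i
  transform : ∀ c d a b, M.resR c d (comp d a b) =
    ∑ i, ∑ j, sgn ((par i + par a) * par b) •
      (M.resL c d (comp c i j) * (M.chart c).jac (M.chart d) j b * (M.chart c).jac (M.chart d) i a)

/-- A symmetric (torsion-free, even) linear connection, by its coefficients
`coeff c i j k = Γ^k_{ij}` in the charts, where `∇_{∂_i} ∂_j = Γ^k_{ij} ∂_k`. -/
structure Connection {n m : ℕ} (M : Supermanifold.{u} n m) where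
  coeff : ∀ c : M.ι, Idx n m → Idx n m → Idx n m → M.Loc c
  parity : ∀ c i j k, coeff c i j k ∈ M.gr _ (par i + par j + par k)
  symm : ∀ c i j k, coeff c i j k = sgn (par i * par j) • coeff c j i k
  transform : ∀ c d i j (a : Idx n m),
    ∑ k, M.resL c d (coeff c i j k) * (M.chart c).jac (M.chart d) k a =
      (M.chart c).pd inf_le_left i ((M.chart c).jac (M.chart d) j a) +
      ∑ b, ∑ e, sgn (par i * (par j + par b)) •
        ((M.chart c).jac (M.chart d) j b * (M.chart c).jac (M.chart d) i e *
          M.resR c d (coeff d e b a))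

/-- The superdimension `n - m`. -/
def sdim (n m : ℕ) : ℝ := (n : ℝ) - (m : ℝ)

/-- The trace-free part `Π^k_{ji} = Γ^k_{ji} - (n-m+1)⁻¹ (Γ^s_{js} δ^k_i (-1)^s
+ Γ^s_{is} δ^k_j (-1)^{ij+s})` of the coefficients of a connection;
`tracefree Γ c j i k = Π^k_{ji}`. -/
def tracefree {n m : ℕ} {M : Supermanifold.{u} n m} (Γ : Connection M) (c : M.ι)
    (j i k : Idx n m) : M.Loc c :=
  Γ.coeff c j i k - (1 / (sdim n m + 1)) •
    ((if k = i then ∑ s, sgn (par s) • Γ.coeff c j s s else 0) +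
     (if k = j then ∑ s, sgn (par i * par j + par s) • Γ.coeff c i s s else 0))

/-- Two symmetric connections are projectively equivalent if their coefficients have the same
trace-free part. -/
def projSetoid {n m : ℕ} (M : Supermanifold.{u} n m) : Setoid (Connection M) where
  r Γ Γ' := tracefree Γ = tracefree Γ'
  iseqv := ⟨fun _ => rfl, fun h => h.symm, fun h h' => h.trans h'⟩

/-- Projective classes of symmetric linear connections. -/
def ProjectiveClass {n m : ℕ} (M : Supermanifold.{u} n m) : Type u := Quotient (projSetoid M)

/-- The invariant `Π^k_{ij}` of a projective class; `P.coeff c i j k = Π^k_{ij}`. -/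
def ProjectiveClass.coeff {n m : ℕ} {M : Supermanifold.{u} n m} (P : ProjectiveClass M) :
    ∀ c : M.ι, Idx n m → Idx n m → Idx n m → M.Loc c :=
  Quotient.lift (s := projSetoid M) tracefree (fun _ _ h => h) P

/-! ### Brackets and Batalin-Vilkovisky operators -/

/-- Odd Poisson brackets on a superalgebra with grading `gr`. -/
structure IsOddPoisson {A : Type u} [Ring A] [Algebra ℝ A] (gr : ZMod 2 → Submodule ℝ A)
    (B : A →ₗ[ℝ] A →ₗ[ℝ] A) : Prop where
  odd : ∀ a b f g, f ∈ gr a → g ∈ gr b → B f g ∈ gr (a + b + 1)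
  antisymm : ∀ a b f g, f ∈ gr a → g ∈ gr b → B f g = -(sgn ((a + 1) * (b + 1)) • B g f)
  jacobi : ∀ a b f g h, f ∈ gr a → g ∈ gr b →
    B f (B g h) = B (B f g) h + sgn ((a + 1) * (b + 1)) • B g (B f h)
  leibniz : ∀ a b f g h, f ∈ gr a → g ∈ gr b →
    B f (g * h) = B f g * h + sgn ((a + 1) * b) • (g * B f h)

/-- `Δ` is a Batalin-Vilkovisky operator for the bracket `B`: it generates `B` and squares to
zero. -/
structure IsBVOperator {A : Type u} [Ring A] [Algebra ℝ A] (gr : ZMod 2 → Submodule ℝ A)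
    (B : A →ₗ[ℝ] A →ₗ[ℝ] A) (Δ : A →ₗ[ℝ] A) : Prop where
  generates : ∀ a f g, f ∈ gr a →
    B f g = sgn a • (Δ (f * g) - Δ f * g - sgn a • (f * Δ g))
  sq_zero : ∀ f, Δ (Δ f) = 0

/-- `B` is the bracket `[f,g] = (-1)^f ((S,f),g)` defined by the master Hamiltonian
`S = S^{ij} p_j p_i`. Here `( , )` is the canonical even Poisson bracket of the cotangent bundle,
with `(p_i, x^j) = δ_i^j`, so that `(S,f) = 2 S^{ij} (-1)^{i f} ∂_j f p_i` and
`((S,f),g) = 2 S^{ij} (-1)^{i f} ∂_j f ∂_i g` in coordinates. -/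
def IsBracketOf {n m : ℕ} {M : Supermanifold.{u} n m} (S : OddTensor M)
    (B : M.Fun →ₗ[ℝ] M.Fun →ₗ[ℝ] M.Fun) : Prop :=
  ∀ (c : M.ι) (a : ZMod 2) (f g : M.Fun), f ∈ M.gr ⊤ a →
    M.toLoc c (B f g) = sgn a • ∑ i, ∑ j, (2 * sgn (par i * a)) •
      (S.comp c i j * (M.chart c).D j (M.toLoc c f) * (M.chart c).D i (M.toLoc c g))

/-! ### The projective Laplacian -/

/-- `T^i = 2/(n-m+3) ∂_j S^{ji} - (n-m+1)/(n-m+3) S^{jk} Π^i_{kj}`. -/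
def Tvec {n m : ℕ} {M : Supermanifold.{u} n m} (P : ProjectiveClass M) (S : OddTensor M)
    (c : M.ι) (i : Idx n m) : M.Loc c :=
  (2 / (sdim n m + 3)) • (∑ j, (M.chart c).D j (S.comp c j i)) -
    ((sdim n m + 1) / (sdim n m + 3)) • (∑ j, ∑ k, S.comp c j k * P.coeff c k j i)

/-- The local expression `S^{ij} ∂_j ∂_i + T^i ∂_i` of the projective Laplacian. -/
def localLaplacian {n m : ℕ} {M : Supermanifold.{u} n m} (P : ProjectiveClass M) (S : OddTensor M)
    (c : M.ι) (f : M.Loc c) : M.Loc c :=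
  (∑ i, ∑ j, S.comp c i j * (M.chart c).D j ((M.chart c).D i f)) +
    ∑ i, Tvec P S c i * (M.chart c).D i f

/-- `Δ` is the projective Laplacian on `C^∞(M)`: in every chart it has the expression
`S^{ij} ∂_j ∂_i + T^i ∂_i`. -/
def IsProjectiveLaplacian {n m : ℕ} {M : Supermanifold.{u} n m} (P : ProjectiveClass M)
    (S : OddTensor M) (Δ : M.Fun →ₗ[ℝ] M.Fun) : Prop :=
  ∀ (c : M.ι) (f : M.Fun), M.toLoc c (Δ f) = localLaplacian P S c (M.toLoc c f)

end SuperGeom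

end

namespace SuperGeom

/-! Any operator S^{ij}∂_j∂_i + T^i∂_i with S supersymmetric and the right parities generates the
bracket of S (`lap_mul`), so the whole question is whether Δ² = 0. The particular form of T^i
matters only through its parity.

A priori Δ² could have order three. Its third-order part measures the failure of the Jacobi
identity, so for an odd Poisson bracket Δ² has order at most two (`sq_secondOrder`). As Δ² also
kills 1, it is determined in a chart by its values on x^i and x^i x^j. Since Δx^i = T^i, the value
on x^i is Δ(T^i), the left side of the first equation; the value on x^i x^j is a combination of
these and of twice the left side of the second equation (`lap_lap_x_mul_x`).

That a differential operator is determined by such data (`diffOp_eq_zero`, `secondOrder_eq_zero`) is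
proved algebraically. The operator E ↦ Σ [E, x^i]∂_i multiplies f∂_w by the length of w; an operator
supercommuting with all x^i has eigenvalue 0, and independence of eigenspaces leaves only
multiplication by E(1).

The hypotheses on the bracket and on Δ concern global functions, while coordinates live on a chart.
Bump functions (`exists_global`) and the locality of differential operators connect the two. -/

theorem sgn_zero : sgn 0 = 1 := if_pos rfl

theorem sgn_one : sgn 1 = -1 := if_neg one_ne_zero

theorem zmod_two_cases (a : ZMod 2) : a = 0 ∨ a = 1 := by
  fin_cases a
  · exact Or.inl rfl
  · exact Or.inr rfl

theorem zmod_two_one_add_one : (1 + 1 : ZMod 2) = 0 := rfl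

theorem sgn_add (a b : ZMod 2) : sgn (a + b) = sgn a * sgn b := by
  rcases zmod_two_cases a with rfl | rfl <;> rcases zmod_two_cases b with rfl | rfl <;>
    simp [sgn_zero, sgn_one, zmod_two_one_add_one]

theorem sgn_mul_self (a : ZMod 2) : sgn a * sgn a = 1 := by
  rcases zmod_two_cases a with rfl | rfl <;> simp [sgn_zero, sgn_one]

theorem sgn_smul_sgn_smul {A : Type*} [AddCommMonoid A] [Module ℝ A] (a : ZMod 2)
    (f : A) : sgn a • sgn a • f = f := by
  rw [smul_smul, sgn_mul_self, one_smul]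

/-! ### Supercommutative superalgebras and parity operators. -/

/-- The grading `gr` makes `A` a supercommutative superalgebra. -/
structure IsSuperalgebra {A : Type*} [Ring A] [Algebra ℝ A] (gr : ZMod 2 → Submodule ℝ A) :
    Prop where
  isInternal : DirectSum.IsInternal gr
  gradedMonoid : SetLike.GradedMonoid gr
  supercomm : ∀ (a b : ZMod 2) (f g : A), f ∈ gr a → g ∈ gr b → f * g = sgn (a * b) • (g * f)

namespace IsSuperalgebra

variable {A : Type*} [Ring A] [Algebra ℝ A] {gr : ZMod 2 → Submodule ℝ A}

theorem mul_mem (H : IsSuperalgebra gr) {a b : ZMod 2} {f g : A} (hf : f ∈ gr a) (hg : g ∈ gr b) :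
    f * g ∈ gr (a + b) :=
  H.gradedMonoid.mul_mem hf hg

theorem one_mem (H : IsSuperalgebra gr) : (1 : A) ∈ gr 0 := H.gradedMonoid.one_mem

/-- The base parity `a` is left free so that the component of any prescribed parity can be extracted
directly. -/
theorem exists_add (H : IsSuperalgebra gr) (a : ZMod 2) (f : A) :
    ∃ g ∈ gr a, ∃ h ∈ gr (a + 1), f = g + h := by
  have h : f ∈ ⨆ b, gr b := by
    rw [H.isInternal.submodule_iSup_eq_top]
    exact Submodule.mem_top
  induction h using Submodule.iSup_induction' with
  | mem b f hf =>
    by_cases hb : b = a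
    · exact ⟨f, hb ▸ hf, 0, zero_mem _, (add_zero f).symm⟩
    · have hb' : b = a + 1 := by
        rcases zmod_two_cases a with rfl | rfl <;> rcases zmod_two_cases b with rfl | rfl <;>
          simp_all [zmod_two_one_add_one]
      exact ⟨0, zero_mem _, f, hb' ▸ hf, (zero_add f).symm⟩
  | zero => exact ⟨0, zero_mem _, 0, zero_mem _, (add_zero 0).symm⟩
  | add f g _ _ hf hg =>
    obtain ⟨f₀, hf₀, f₁, hf₁, rfl⟩ := hf
    obtain ⟨g₀, hg₀, g₁, hg₁, rfl⟩ := hg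
    exact ⟨_, add_mem hf₀ hg₀, _, add_mem hf₁ hg₁, by abel⟩

theorem induction (H : IsSuperalgebra gr) {C : A → Prop} (hadd : ∀ f g, C f → C g → C (f + g))
    (hgr : ∀ a, ∀ f ∈ gr a, C f) (f : A) : C f := by
  obtain ⟨g, hg, h, hh, rfl⟩ := H.exists_add 0 f
  exact hadd _ _ (hgr _ _ hg) (hgr _ _ hh)

theorem eq_zero_of_mem_of_mem (H : IsSuperalgebra gr) {a : ZMod 2} {f : A} (h₀ : f ∈ gr a)
    (h₁ : f ∈ gr (a + 1)) : f = 0 :=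
  Submodule.disjoint_def.1 (H.isInternal.submodule_iSupIndep.pairwiseDisjoint
    (show a ≠ a + 1 by simp)) f h₀ h₁

theorem ext_end (H : IsSuperalgebra gr) {E F : Module.End ℝ A}
    (h : ∀ a, ∀ f ∈ gr a, E f = F f) : E = F :=
  LinearMap.ext (H.induction (fun f g hf hg => by rw [map_add, map_add, hf, hg]) h)

theorem exists_parityOp (H : IsSuperalgebra gr) (b : ZMod 2) :
    ∃ ε : Module.End ℝ A, ∀ a, ∀ f ∈ gr a, ε f = sgn (b * a) • f := by
  let e := LinearEquiv.ofBijective (DirectSum.coeLinearMap gr) H.isInternal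
  refine ⟨DirectSum.toModule ℝ (ZMod 2) A (fun a => sgn (b * a) • (gr a).subtype) ∘ₗ
    e.symm.toLinearMap, fun a f hf => ?_⟩
  have h : e.symm f = DirectSum.lof ℝ (ZMod 2) (fun a => gr a) a ⟨f, hf⟩ := by
    rw [LinearEquiv.symm_apply_eq]
    exact (DirectSum.coeLinearMap_lof gr a ⟨f, hf⟩).symm
  simp [h]

/-- The operator which is multiplication by `(-1)^(b a)` on elements of parity `a`. -/
noncomputable def parityOp (H : IsSuperalgebra gr) (b : ZMod 2) : Module.End ℝ A :=
  (H.exists_parityOp b).choose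

theorem parityOp_apply (H : IsSuperalgebra gr) (b : ZMod 2) {a : ZMod 2} {f : A} (hf : f ∈ gr a) :
    H.parityOp b f = sgn (b * a) • f :=
  (H.exists_parityOp b).choose_spec a f hf

theorem parityOp_mul_self (H : IsSuperalgebra gr) (b : ZMod 2) :
    H.parityOp b * H.parityOp b = 1 :=
  H.ext_end fun a f hf => by
    rw [Module.End.mul_apply, H.parityOp_apply b hf, map_smul, H.parityOp_apply b hf,
      sgn_smul_sgn_smul, Module.End.one_apply]

/-- Conjugation by `parityOp b` produces the sign of a supercommutator. Being linear in `E`, it also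
makes sense for operators without a parity. -/
theorem parityOp_mul (H : IsSuperalgebra gr) (b : ZMod 2) {c : ZMod 2} {E : Module.End ℝ A}
    (hE : ∀ a, ∀ f ∈ gr a, E f ∈ gr (c + a)) :
    H.parityOp b * E = sgn (b * c) • (E * H.parityOp b) :=
  H.ext_end fun a f hf => by
    rw [Module.End.mul_apply, H.parityOp_apply b (hE a f hf), LinearMap.smul_apply,
      Module.End.mul_apply, H.parityOp_apply b hf, map_smul, smul_smul, ← sgn_add, mul_add]

end IsSuperalgebra

/-! ### Differential operators in abstract supercoordinates, and their determination by values on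
coordinates. -/

/-- Coordinates `x` of parities `p` on a superalgebra, with their left partial derivatives `d`. -/
structure SuperCoords {A J : Type*} [Ring A] [Algebra ℝ A] [DecidableEq J]
    (gr : ZMod 2 → Submodule ℝ A) (p : J → ZMod 2) where
  d : J → Module.End ℝ A
  x : J → A
  d_mem : ∀ i a, ∀ f ∈ gr a, d i f ∈ gr (p i + a)
  x_mem : ∀ i, x i ∈ gr (p i)
  leibniz : ∀ i a, ∀ f ∈ gr a, ∀ g, d i (f * g) = d i f * g + sgn (p i * a) • (f * d i g)
  comm : ∀ i j f, d i (d j f) = sgn (p i * p j) • d j (d i f)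
  d_x : ∀ i j, d i (x j) = if i = j then 1 else 0

namespace SuperCoords

variable {A J : Type*} [Ring A] [Algebra ℝ A] [DecidableEq J]
  {gr : ZMod 2 → Submodule ℝ A} {p : J → ZMod 2}

theorem d_one (X : SuperCoords gr p) (H : IsSuperalgebra gr) (i : J) : X.d i 1 = 0 := by
  have h := X.leibniz i 0 1 H.one_mem 1
  simp only [mul_one, mul_zero, sgn_zero, one_smul, one_mul] at h
  exact left_eq_add.1 h

theorem d_d_x (X : SuperCoords gr p) (H : IsSuperalgebra gr) (i j k : J) :
    X.d i (X.d j (X.x k)) = 0 := by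
  rw [X.d_x]
  split_ifs
  · exact X.d_one H i
  · exact map_zero _

/-- Iterated partial derivatives. -/
def dWord (X : SuperCoords gr p) : List J → Module.End ℝ A
  | [] => 1
  | i :: w => X.d i * X.dWord w

/-- The algebra of differential operators with coefficients in `A`. -/
def diffOps (X : SuperCoords gr p) : Subalgebra ℝ (Module.End ℝ A) :=
  Algebra.adjoin ℝ ({E | ∃ a, ∃ f ∈ gr a, E = LinearMap.mulLeft ℝ f} ∪ Set.range X.d)

theorem d_mem_diffOps (X : SuperCoords gr p) (i : J) : X.d i ∈ X.diffOps :=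
  Algebra.subset_adjoin (Or.inr ⟨i, rfl⟩)

theorem mulLeft_mem_diffOps (X : SuperCoords gr p) (H : IsSuperalgebra gr) (f : A) :
    LinearMap.mulLeft ℝ f ∈ X.diffOps := by
  induction f using H.induction with
  | hadd f g hf hg =>
    rw [show LinearMap.mulLeft ℝ (f + g) = LinearMap.mulLeft ℝ f + LinearMap.mulLeft ℝ g from
      LinearMap.ext fun h => add_mul f g h]
    exact add_mem hf hg
  | hgr a f hf => exact Algebra.subset_adjoin (Or.inl ⟨a, f, hf, rfl⟩)

theorem d_mul_mulLeft (X : SuperCoords gr p) (i : J) {a : ZMod 2} {f : A} (hf : f ∈ gr a) :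
    X.d i * LinearMap.mulLeft ℝ f =
      LinearMap.mulLeft ℝ (X.d i f) + sgn (p i * a) • (LinearMap.mulLeft ℝ f * X.d i) :=
  LinearMap.ext fun g => X.leibniz i a f hf g

/-- Every differential operator is a combination of the operators `f ∂_w`. -/
theorem diffOps_le_span (X : SuperCoords gr p) (H : IsSuperalgebra gr) :
    Subalgebra.toSubmodule X.diffOps ≤
      Submodule.span ℝ {E | ∃ a, ∃ f ∈ gr a, ∃ w, E = LinearMap.mulLeft ℝ f * X.dWord w} := by
  intro E hE
  set N := Submodule.span ℝ {E | ∃ a, ∃ f ∈ gr a, ∃ w, E = LinearMap.mulLeft ℝ f * X.dWord w}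
  have h1 : (1 : Module.End ℝ A) ∈ N :=
    Submodule.subset_span ⟨0, 1, H.one_mem, [], LinearMap.ext fun g => (one_mul g).symm⟩
  -- It is enough that left multiplication by `E` preserves the span, since the span contains 1;
  -- this form passes through sums and products of generators.
  suffices h : ∀ F ∈ N, E * F ∈ N by simpa using h 1 h1
  have hE' : E ∈ X.diffOps := hE
  clear hE
  induction hE' using Algebra.adjoin_induction with
  | mem E hE =>
    intro F hF
    induction hF using Submodule.span_induction with
    | mem F hF =>
      obtain ⟨a, f, hf, w, rfl⟩ := hF
      rcases hE with ⟨b, g, hg, rfl⟩ | ⟨i, rfl⟩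
      · exact Submodule.subset_span ⟨b + a, g * f, H.mul_mem hg hf, w,
          LinearMap.ext fun h => (mul_assoc g f _).symm⟩
      · rw [← mul_assoc, X.d_mul_mulLeft i hf, add_mul, smul_mul_assoc, mul_assoc]
        exact add_mem (Submodule.subset_span ⟨_, _, X.d_mem i a f hf, w, rfl⟩)
          (N.smul_mem _ (Submodule.subset_span ⟨a, f, hf, i :: w, rfl⟩))
    | zero => simp
    | add F G _ _ hF hG => rw [mul_add]; exact add_mem hF hG
    | smul r F _ hF => rw [mul_smul_comm]; exact N.smul_mem r hF
  | algebraMap r =>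
    intro F hF
    rw [← Algebra.smul_def]
    exact N.smul_mem r hF
  | add E F hE hF ihE ihF =>
    intro G hG
    rw [add_mul]
    exact add_mem (ihE G hG) (ihF G hG)
  | mul E F hE hF ihE ihF =>
    intro G hG
    rw [mul_assoc]
    exact ihE _ (ihF G hG)

/-- Conjugation contributes one sign for each letter of `w`, exactly the sign for moving ∂_j to the
left past that letter. -/
theorem conj_dWord_mul_d (X : SuperCoords gr p) (H : IsSuperalgebra gr) (j : J) (w : List J) :
    H.parityOp (p j) * X.dWord w * H.parityOp (p j) * X.d j = X.d j * X.dWord w := by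
  induction w with
  | nil => simp [dWord, H.parityOp_mul_self]
  | cons i w ih =>
    have hc : X.d i * X.d j = sgn (p j * p i) • (X.d j * X.d i) :=
      LinearMap.ext fun f => by rw [mul_comm (p j)]; exact X.comm i j f
    rw [dWord, ← mul_assoc, H.parityOp_mul (p j) (X.d_mem i)]
    simp only [smul_mul_assoc]
    rw [mul_assoc (X.d i), mul_assoc (X.d i), mul_assoc (X.d i), ih, ← mul_assoc, hc,
      smul_mul_assoc, sgn_smul_sgn_smul, mul_assoc]

variable [Fintype J]

/-- The operator `E ↦ ∑ i, [E, x i] ∂_i`, of which `f ∂_w` is an eigenvector for the eigenvalue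
`|w|`. -/
noncomputable def euler (X : SuperCoords gr p) (H : IsSuperalgebra gr) :
    Module.End ℝ (Module.End ℝ A) :=
  ∑ i, (LinearMap.mulRight ℝ (LinearMap.mulLeft ℝ (X.x i) * X.d i) -
    LinearMap.mulLeft ℝ (LinearMap.mulLeft ℝ (X.x i) * H.parityOp (p i)) ∘ₗ
      LinearMap.mulRight ℝ (H.parityOp (p i) * X.d i))

/-- The bracketed difference is the supercommutator of `E` with x^i: on an `E` of parity e, the
conjugation supplies (-1)^{p_i e}. -/
theorem euler_apply (X : SuperCoords gr p) (H : IsSuperalgebra gr) (E : Module.End ℝ A) :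
    X.euler H E = ∑ i, (E * LinearMap.mulLeft ℝ (X.x i) -
      LinearMap.mulLeft ℝ (X.x i) * (H.parityOp (p i) * E * H.parityOp (p i))) * X.d i := by
  simp only [euler, LinearMap.sum_apply, LinearMap.sub_apply, LinearMap.comp_apply,
    LinearMap.mulRight_apply, LinearMap.mulLeft_apply, sub_mul, mul_assoc]

/-- Multiplication by `f` supercommutes with multiplication by x^i; the sign of that exchange
cancels the one from conjugating `f`. -/
theorem euler_mulLeft_mul (X : SuperCoords gr p) (H : IsSuperalgebra gr) {a : ZMod 2} {f : A}
    (hf : f ∈ gr a) (E : Module.End ℝ A) :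
    X.euler H (LinearMap.mulLeft ℝ f * E) = LinearMap.mulLeft ℝ f * X.euler H E := by
  rw [euler_apply, euler_apply, Finset.mul_sum]
  refine Finset.sum_congr rfl fun i _ => ?_
  have h₁ : H.parityOp (p i) * LinearMap.mulLeft ℝ f =
      sgn (p i * a) • (LinearMap.mulLeft ℝ f * H.parityOp (p i)) :=
    H.parityOp_mul (p i) fun b g hg => H.mul_mem hf hg
  have h₂ : LinearMap.mulLeft ℝ (X.x i) * LinearMap.mulLeft ℝ f =
      sgn (p i * a) • (LinearMap.mulLeft ℝ f * LinearMap.mulLeft ℝ (X.x i)) :=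
    LinearMap.ext fun g => by
      simp only [Module.End.mul_apply, LinearMap.smul_apply, LinearMap.mulLeft_apply, ← mul_assoc,
        H.supercomm _ _ _ _ (X.x_mem i) hf, smul_mul_assoc]
  rw [← mul_assoc (H.parityOp _) (LinearMap.mulLeft ℝ f) E, h₁]
  simp only [smul_mul_assoc, mul_smul_comm]
  rw [show LinearMap.mulLeft ℝ (X.x i) *
      (LinearMap.mulLeft ℝ f * H.parityOp (p i) * E * H.parityOp (p i)) =
      (LinearMap.mulLeft ℝ (X.x i) * LinearMap.mulLeft ℝ f) *
        (H.parityOp (p i) * E * H.parityOp (p i)) by simp only [mul_assoc], h₂, smul_mul_assoc,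
    sgn_smul_sgn_smul]
  simp only [mul_sub, sub_mul, mul_assoc]

/-- Prepending ∂_j adds the contribution of [∂_j, x^i] = δ_ij, a conjugate of ∂_w followed by ∂_j.
By `conj_dWord_mul_d` this is ∂_j∂_w once more, so the eigenvalue rises by one. -/
theorem euler_dWord (X : SuperCoords gr p) (H : IsSuperalgebra gr) (w : List J) :
    X.euler H (X.dWord w) = (w.length : ℝ) • X.dWord w := by
  induction w with
  | nil =>
    rw [euler_apply]
    simp [dWord, H.parityOp_mul_self]
  | cons j w ih =>
    have h : X.euler H (X.d j * X.dWord w) = X.d j * X.euler H (X.dWord w) +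
        H.parityOp (p j) * X.dWord w * H.parityOp (p j) * X.d j := by
      -- The extra term is written as a sum with a Kronecker delta so that both sides can be
      -- compared index by index.
      have hj : H.parityOp (p j) * X.dWord w * H.parityOp (p j) * X.d j = ∑ i, if j = i then
          H.parityOp (p i) * X.dWord w * H.parityOp (p i) * X.d i else 0 := by simp
      rw [hj, euler_apply, euler_apply, Finset.mul_sum, ← Finset.sum_add_distrib]
      refine Finset.sum_congr rfl fun i _ => ?_
      have h₁ := X.d_mul_mulLeft j (X.x_mem i)
      rw [X.d_x] at h₁
      have h₂ : LinearMap.mulLeft ℝ (X.x i) *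
          (H.parityOp (p i) * (X.d j * X.dWord w) * H.parityOp (p i)) =
          X.d j * LinearMap.mulLeft ℝ (X.x i) *
              (H.parityOp (p i) * X.dWord w * H.parityOp (p i)) -
            LinearMap.mulLeft ℝ (if j = i then 1 else 0) *
              (H.parityOp (p i) * X.dWord w * H.parityOp (p i)) := by
        rw [h₁, add_mul, add_sub_cancel_left, ← mul_assoc (H.parityOp (p i)),
          H.parityOp_mul (p i) (X.d_mem j), mul_comm (p i)]
        simp only [smul_mul_assoc, mul_smul_comm, mul_assoc]
      rw [h₂]
      split_ifs
      · rw [LinearMap.mulLeft_one, ← Module.End.one_eq_id]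
        simp only [sub_mul, mul_sub, mul_assoc, one_mul]
        abel
      · rw [LinearMap.mulLeft_zero_eq_zero]
        simp only [sub_mul, mul_sub, mul_assoc, zero_mul, sub_zero, add_zero]
    rw [dWord, h, ih, conj_dWord_mul_d, mul_smul_comm, List.length_cons, Nat.cast_succ, add_smul,
      one_smul]

/-- A homogeneous differential operator that kills `1` and supercommutes with the coordinates is
zero. -/
theorem diffOp_eq_zero (X : SuperCoords gr p) (H : IsSuperalgebra gr) {E : Module.End ℝ A}
    (hE : E ∈ X.diffOps) {a : ZMod 2} (ha : ∀ b, ∀ f ∈ gr b, E f ∈ gr (a + b)) (h1 : E 1 = 0)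
    (hx : ∀ i f, E (X.x i * f) = sgn (p i * a) • (X.x i * E f)) : E = 0 := by
  -- All supercommutators with coordinates vanish, hence so does their sum.
  have h₀ : E ∈ (X.euler H).eigenspace 0 := by
    rw [Module.End.mem_eigenspace_iff, zero_smul, euler_apply]
    refine Finset.sum_eq_zero fun i _ => ?_
    rw [H.parityOp_mul (p i) ha, smul_mul_assoc, mul_assoc E, H.parityOp_mul_self, mul_one,
      show E * LinearMap.mulLeft ℝ (X.x i) = LinearMap.mulLeft ℝ (X.x i) * sgn (p i * a) • E from
        LinearMap.ext fun f => (hx i f).trans (mul_smul_comm _ _ _).symm, sub_self, zero_mul]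
  -- Splits off the order-zero part, which is multiplication by the value at 1, from a sum of
  -- eigenvectors with nonzero eigenvalues.
  have hdec : ∀ F ∈ Submodule.span ℝ
      {E | ∃ a, ∃ f ∈ gr a, ∃ w, E = LinearMap.mulLeft ℝ f * X.dWord w},
      ∃ G ∈ ⨆ r, ⨆ _ : r ≠ (0 : ℝ), (X.euler H).eigenspace r,
        G 1 = 0 ∧ F = LinearMap.mulLeft ℝ (F 1) + G := by
    intro F hF
    induction hF using Submodule.span_induction with
    | mem F hF =>
      obtain ⟨b, f, hf, w, rfl⟩ := hF
      match w with
      | [] => exact ⟨0, zero_mem _, rfl, LinearMap.ext fun g => by simp [dWord]⟩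
      | i :: w =>
        have hw : X.dWord (i :: w) 1 = 0 := by
          clear * - H
          induction w generalizing i with
          | nil => simpa [dWord] using X.d_one H i
          | cons j w ih => rw [dWord, Module.End.mul_apply, ih, map_zero]
        have hw' : (LinearMap.mulLeft ℝ f * X.dWord (i :: w)) 1 = 0 := by
          rw [Module.End.mul_apply, hw, map_zero]
        refine ⟨_, Submodule.mem_iSup_of_mem ((i :: w).length : ℝ) (Submodule.mem_iSup_of_mem
          (Nat.cast_ne_zero.2 (List.cons_ne_nil i w |> mt List.length_eq_zero_iff.1)) ?_), hw', ?_⟩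
        · rw [Module.End.mem_eigenspace_iff, X.euler_mulLeft_mul H hf, X.euler_dWord H,
            mul_smul_comm]
        · rw [hw', LinearMap.mulLeft_zero_eq_zero, zero_add]
    | zero => exact ⟨0, zero_mem _, rfl, by simp⟩
    | add F F' _ _ hF hF' =>
      obtain ⟨G, hG, hG1, hF⟩ := hF
      obtain ⟨G', hG', hG1', hF'⟩ := hF'
      refine ⟨G + G', add_mem hG hG', by simp [hG1, hG1'], ?_⟩
      conv_lhs => rw [hF, hF']
      ext g
      simp only [LinearMap.add_apply, LinearMap.mulLeft_apply, add_mul]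
      abel
    | smul r F _ hF =>
      obtain ⟨G, hG, hG1, hF⟩ := hF
      refine ⟨r • G, Submodule.smul_mem _ r hG, by simp [hG1], ?_⟩
      conv_lhs => rw [hF]
      ext g
      simp
  obtain ⟨G, hG, -, hEG⟩ := hdec E (X.diffOps_le_span H hE)
  rw [h1, LinearMap.mulLeft_zero_eq_zero, zero_add] at hEG
  exact Submodule.disjoint_def.1 ((X.euler H).eigenspaces_iSupIndep 0) E h₀ (hEG ▸ hG)

/-- An even differential operator of order at most two without constant term that kills the
coordinates, and whose symbol kills pairs of coordinates, is zero. -/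
theorem secondOrder_eq_zero (X : SuperCoords gr p) (H : IsSuperalgebra gr) {E : Module.End ℝ A}
    (hE : E ∈ X.diffOps) (hpar : ∀ b, ∀ f ∈ gr b, E f ∈ gr b) (h1 : E 1 = 0)
    (hx : ∀ i, E (X.x i) = 0) (hxx : ∀ i j, E (X.x i * X.x j) = 0)
    (hord : ∀ i j h, (E (X.x i * (X.x j * h)) - E (X.x i) * (X.x j * h) - X.x i * E (X.x j * h)) =
      (E (X.x i * X.x j) - E (X.x i) * X.x j - X.x i * E (X.x j)) * h +
        sgn (p i * p j) • (X.x j * (E (X.x i * h) - E (X.x i) * h - X.x i * E h))) : E = 0 := by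
  refine X.diffOp_eq_zero H hE (a := 0) (by simpa using hpar) h1 fun i f => ?_
  -- The commutator with x^i satisfies the hypotheses of `diffOp_eq_zero`: by `hord` it
  -- supercommutes with the x^j. Once it is known to vanish, the same lemma applies to `E`.
  let F : Module.End ℝ A := E * LinearMap.mulLeft ℝ (X.x i) - LinearMap.mulLeft ℝ (X.x i) * E
  have hF : F = 0 := by
    have hm := X.mulLeft_mem_diffOps H (X.x i)
    refine X.diffOp_eq_zero H (a := p i) (sub_mem (mul_mem hE hm) (mul_mem hm hE))
      (fun b f hf => sub_mem (hpar _ _ (H.mul_mem (X.x_mem i) hf))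
        (H.mul_mem (X.x_mem i) (hpar _ _ hf))) ?_ fun j f => ?_
    · simp [F, h1, hx]
    · have h := hord i j f
      simp only [hx, hxx, zero_mul, mul_zero, sub_zero, zero_add] at h
      rw [mul_comm (p j)]
      exact h
  have h := LinearMap.congr_fun hF f
  rw [mul_zero, sgn_zero, one_smul]
  exact sub_eq_zero.1 h

end SuperCoords

/-! ### Second-order operators S^{ij}∂_j∂_i + T^i∂_i. -/

namespace SuperCoords

variable {A J : Type*} [Ring A] [Algebra ℝ A] [DecidableEq J] [Fintype J]
  {gr : ZMod 2 → Submodule ℝ A} {p : J → ZMod 2}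

/-- The operator `S^{ij} ∂_j ∂_i + T^i ∂_i`. -/
noncomputable def lap (X : SuperCoords gr p) (S : J → J → A) (T : J → A) : Module.End ℝ A :=
  ∑ i, ∑ j, LinearMap.mulLeft ℝ (S i j) * (X.d j * X.d i) + ∑ i, LinearMap.mulLeft ℝ (T i) * X.d i

theorem lap_apply (X : SuperCoords gr p) (S : J → J → A) (T : J → A) (f : A) :
    X.lap S T f = ∑ i, ∑ j, S i j * X.d j (X.d i f) + ∑ i, T i * X.d i f := by
  simp [lap, LinearMap.sum_apply]

theorem lap_mem_diffOps (X : SuperCoords gr p) (H : IsSuperalgebra gr) (S : J → J → A)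
    (T : J → A) : X.lap S T ∈ X.diffOps :=
  add_mem (sum_mem fun i _ => sum_mem fun j _ => mul_mem (X.mulLeft_mem_diffOps H _)
      (mul_mem (X.d_mem_diffOps j) (X.d_mem_diffOps i)))
    (sum_mem fun i _ => mul_mem (X.mulLeft_mem_diffOps H _) (X.d_mem_diffOps i))

theorem lap_one (X : SuperCoords gr p) (H : IsSuperalgebra gr) (S : J → J → A) (T : J → A) :
    X.lap S T 1 = 0 := by
  simp [lap_apply, X.d_one H]

theorem lap_x (X : SuperCoords gr p) (H : IsSuperalgebra gr) (S : J → J → A) (T : J → A) (i : J) :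
    X.lap S T (X.x i) = T i := by
  simp only [lap_apply, X.d_d_x H, mul_zero, Finset.sum_const_zero, zero_add]
  simp [X.d_x]

/-- The polarized symbol `2 S^{ij} (-1)^{i a} ∂_j f ∂_i g` of `S^{ij} ∂_j ∂_i`, where `f` has
parity `a`. -/
noncomputable def symbol (X : SuperCoords gr p) (S : J → J → A) (a : ZMod 2) (f g : A) : A :=
  ∑ i, ∑ j, (2 * sgn (p i * a)) • (S i j * X.d j f * X.d i g)

variable {S : J → J → A} {T : J → A}

theorem lap_mem (X : SuperCoords gr p) (H : IsSuperalgebra gr)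
    (hS : ∀ i j, S i j ∈ gr (p i + p j + 1)) (hT : ∀ i, T i ∈ gr (p i + 1)) {a : ZMod 2} {f : A}
    (hf : f ∈ gr a) : X.lap S T f ∈ gr (a + 1) := by
  rw [lap_apply]
  refine add_mem (sum_mem fun i _ => sum_mem fun j _ => ?_) (sum_mem fun i _ => ?_)
  · have h := H.mul_mem (hS i j) (X.d_mem j _ _ (X.d_mem i _ _ hf))
    rwa [show p i + p j + 1 + (p j + (p i + a)) = a + 1 + (p i + p i) + (p j + p j) by ring,
      CharTwo.add_self_eq_zero, CharTwo.add_self_eq_zero, add_zero, add_zero] at h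
  · have h := H.mul_mem (hT i) (X.d_mem i _ _ hf)
    rwa [show p i + 1 + (p i + a) = a + 1 + (p i + p i) by ring,
      CharTwo.add_self_eq_zero, add_zero] at h

/-- Two applications of the Leibniz rule leave two cross terms, which differ by exchanging i and j;
supersymmetry of S makes their sums equal, whence the factor 2 in `symbol`. -/
theorem lap_mul (X : SuperCoords gr p) (H : IsSuperalgebra gr)
    (hS : ∀ i j, S i j ∈ gr (p i + p j + 1)) (hsymm : ∀ i j, S i j = sgn (p i * p j) • S j i)
    (hT : ∀ i, T i ∈ gr (p i + 1)) {a : ZMod 2} {f : A} (hf : f ∈ gr a) (g : A) :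
    X.lap S T (f * g) =
      X.lap S T f * g + sgn a • (f * X.lap S T g) + X.symbol S a f g := by
  have h₂ : ∀ i j, S i j * X.d j (X.d i (f * g)) = S i j * X.d j (X.d i f) * g +
      sgn a • (f * (S i j * X.d j (X.d i g))) + sgn (p i * a) • (S i j * X.d j f * X.d i g) +
      sgn (p j * a) • (S j i * X.d i f * X.d j g) := by
    intro i j
    have hc : S i j * f = sgn ((p i + p j + 1) * a) • (f * S i j) :=
      H.supercomm _ _ _ _ (hS i j) hf
    have hc' : S i j * (f * X.d j (X.d i g)) =
        sgn ((p i + p j + 1) * a) • (f * (S i j * X.d j (X.d i g))) := by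
      rw [← mul_assoc, hc, smul_mul_assoc, mul_assoc]
    rw [X.leibniz i a f hf, map_add, map_smul, X.leibniz j _ _ (X.d_mem i a f hf),
      X.leibniz j a f hf, hsymm j i]
    simp only [mul_add, mul_smul_comm, smul_add, smul_mul_assoc, hc', smul_smul, ← sgn_add,
      mul_assoc]
    rw [show p i * a + p j * a + (p i + p j + 1) * a = a + (p i * a + p i * a) +
      (p j * a + p j * a) by ring, CharTwo.add_self_eq_zero, CharTwo.add_self_eq_zero, add_zero,
      add_zero, add_comm (p j * p i)]
    abel
  have h₁ : ∀ i, T i * X.d i (f * g) = T i * X.d i f * g + sgn a • (f * (T i * X.d i g)) := by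
    intro i
    have hc : T i * f = sgn ((p i + 1) * a) • (f * T i) := H.supercomm _ _ _ _ (hT i) hf
    have hc' : T i * (f * X.d i g) = sgn ((p i + 1) * a) • (f * (T i * X.d i g)) := by
      rw [← mul_assoc, hc, smul_mul_assoc, mul_assoc]
    rw [X.leibniz i a f hf, mul_add, mul_smul_comm, hc', smul_smul, ← sgn_add, mul_assoc,
      show p i * a + (p i + 1) * a = a + (p i * a + p i * a) by ring, CharTwo.add_self_eq_zero,
      add_zero]
  simp only [lap_apply, symbol, h₁, h₂, Finset.sum_add_distrib, add_mul, mul_add, Finset.sum_mul,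
    Finset.mul_sum, smul_add, Finset.smul_sum, two_mul, add_smul]
  rw [Finset.sum_comm (f := fun i j => sgn (p j * a) • (S j i * X.d i f * X.d j g))]
  abel

theorem symbol_x_left (X : SuperCoords gr p)
    (hsymm : ∀ i j, S i j = sgn (p i * p j) • S j i) (i : J) (g : A) :
    X.symbol S (p i) (X.x i) g = (2 : ℝ) • ∑ k, S i k * X.d k g := by
  have h : ∀ k, (∑ j, (2 * sgn (p k * p i)) • (S k j * X.d j (X.x i) * X.d k g)) =
      (2 : ℝ) • (S i k * X.d k g) := by
    intro k
    rw [Finset.sum_eq_single i (fun j _ hj => by simp [X.d_x, hj]) (by simp), X.d_x, if_pos rfl,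
      mul_one, hsymm i k, smul_mul_assoc, smul_smul, mul_comm (p k)]
  simp only [symbol, h, Finset.smul_sum]

theorem symbol_x_right (X : SuperCoords gr p) (a : ZMod 2) (f : A) (j : J) :
    X.symbol S a f (X.x j) = (2 * sgn (p j * a)) • ∑ k, S j k * X.d k f := by
  rw [symbol, Finset.sum_eq_single j (fun i _ hi => by simp [X.d_x, hi]) (by simp),
    Finset.smul_sum]
  simp [X.d_x]

/-- The square of `S^{ij} ∂_j ∂_i + T^i ∂_i` on a product of two coordinates. -/
theorem lap_lap_x_mul_x (X : SuperCoords gr p) (H : IsSuperalgebra gr)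
    (hS : ∀ i j, S i j ∈ gr (p i + p j + 1)) (hsymm : ∀ i j, S i j = sgn (p i * p j) • S j i)
    (hT : ∀ i, T i ∈ gr (p i + 1)) (i j : J) :
    X.lap S T (X.lap S T (X.x i * X.x j)) = X.lap S T (X.lap S T (X.x i)) * X.x j +
      X.x i * X.lap S T (X.lap S T (X.x j)) +
      (2 : ℝ) • (X.lap S T (S i j) + ∑ k, sgn (p i) • (S i k * X.d k (T j)) +
        ∑ k, sgn (p j * (p i + 1)) • (S j k * X.d k (T i))) := by
  -- The two terms T^i T^j have opposite signs and cancel. The symbol of (x^i, x^j) is 2S^{ij}, and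
  -- those of (x^i, T^j) and (T^i, x^j) give the two remaining sums.
  rw [X.lap_mul H hS hsymm hT (X.x_mem i), map_add, map_add, map_smul,
    X.lap_mul H hS hsymm hT (X.x_mem i), X.lap_mul H hS hsymm hT (X.lap_mem H hS hT (X.x_mem i)),
    X.symbol_x_left hsymm, X.symbol_x_right, X.symbol_x_left hsymm, map_smul, X.lap_x H, X.lap_x H]
  simp only [X.d_x, mul_ite, mul_one, mul_zero, Finset.sum_ite_eq', Finset.mem_univ, if_true,
    smul_add, smul_smul, sgn_add, sgn_one, ← Finset.smul_sum, sgn_mul_self]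
  rw [mul_comm (sgn (p i)) 2]
  module

end SuperCoords

/-! ### The Jacobi identity and the order of Δ². -/

/-- If an odd operator generates an odd Poisson bracket, then its square is an operator of order at
most two. -/
theorem sq_secondOrder {A : Type u} [Ring A] [Algebra ℝ A] {gr : ZMod 2 → Submodule ℝ A}
    {B : A →ₗ[ℝ] A →ₗ[ℝ] A} (hB : IsOddPoisson gr B) {Δ : A →ₗ[ℝ] A}
    (hΔ : ∀ a, ∀ f ∈ gr a, Δ f ∈ gr (a + 1))
    (hgen : ∀ a f g, f ∈ gr a → Δ (f * g) = Δ f * g + sgn a • (f * Δ g) + sgn a • B f g)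
    {a b : ZMod 2} {f g : A} (hf : f ∈ gr a) (hg : g ∈ gr b) (hfg : f * g ∈ gr (a + b)) (h : A) :
    Δ (Δ (f * (g * h))) - Δ (Δ f) * (g * h) - f * Δ (Δ (g * h)) =
      (Δ (Δ (f * g)) - Δ (Δ f) * g - f * Δ (Δ g)) * h +
        sgn (a * b) • (g * (Δ (Δ (f * h)) - Δ (Δ f) * h - f * Δ (Δ h))) := by
  -- The failure of Δ² to be a derivation is the failure of Δ to be a derivation of the bracket.
  have hF : ∀ k, Δ (Δ (f * k)) - Δ (Δ f) * k - f * Δ (Δ k) =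
      sgn a • (Δ (B f k) - B (Δ f) k) + B f (Δ k) := by
    intro k
    rw [hgen a f k hf, map_add, map_add, map_smul, map_smul, hgen _ _ k (hΔ a f hf),
      hgen a f (Δ k) hf, sgn_add, sgn_one]
    simp only [smul_add, smul_smul, sgn_mul_self, one_smul, mul_neg, mul_one, neg_smul, smul_sub]
    abel
  have hBfg := hgen _ (B f g) h (hB.odd a b f g hf hg)
  have hgB := hgen _ g (B f h) hg
  have hgh := hgen _ g h hg
  -- Expanding Δ(gh) inside the bracket creates [f,[g,h]]; Jacobi cancels it against the brackets
  -- [[f,g],h] and [g,[f,h]] that come from Δ of products.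
  have hjac := hB.jacobi a b f g h hf hg
  have hL := hB.leibniz a b f g h hf hg
  have hL₁ := hB.leibniz (a + 1) b (Δ f) g h (hΔ a f hf) hg
  have hL₂ := hB.leibniz a (b + 1) f (Δ g) h hf (hΔ b g hg)
  have hL₃ := hB.leibniz a b f g (Δ h) hf hg
  rw [hF, hF, hF, hL, hL₁, hgh]
  simp only [map_add, map_smul, hBfg, hgB, hL₂, hL₃, hjac]
  rcases zmod_two_cases a with rfl | rfl <;> rcases zmod_two_cases b with rfl | rfl <;>
    simp only [sgn_zero, sgn_one, zmod_two_one_add_one, add_zero, zero_add, mul_zero,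
      mul_one, one_smul, neg_smul, mul_add, add_mul, mul_sub, sub_mul, neg_mul, mul_neg,
      smul_add, smul_sub, smul_neg, neg_neg] <;>
    abel

/-! ### Derivatives of superfunctions -/

theorem neg_one_pow_eq_sgn {k : ℕ} {a : ZMod 2} (h : (k : ZMod 2) = a) : (-1 : ℝ) ^ k = sgn a := by
  subst h
  rcases Nat.even_or_odd k with hk | hk
  · rw [hk.neg_one_pow, (ZMod.natCast_eq_zero_iff_even).2 hk, sgn_zero]
  · rw [hk.neg_one_pow, (ZMod.natCast_eq_one_iff_odd).2 hk, sgn_one]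

namespace Grassmann

variable {m : ℕ}

/-- The new inversions are the pairs (j, b) with b < j. -/
theorem card_filter_insert_left {j : Fin m} {I R : Finset (Fin m)} (hI : j ∉ I) :
    ((insert j I ×ˢ R).filter (fun q => q.2 < q.1)).card =
      ((I ×ˢ R).filter (fun q => q.2 < q.1)).card + (R.filter (· < j)).card := by
  rw [Finset.insert_eq, Finset.union_product, Finset.singleton_product, Finset.filter_union,
    Finset.card_union_of_disjoint, add_comm]
  · congr 1
    rw [Finset.filter_map, Finset.card_map]
    rfl
  · rw [Finset.disjoint_left]
    intro q hq hq'
    obtain ⟨r, -, rfl⟩ := Finset.mem_map.1 (Finset.mem_filter.1 hq).1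
    exact hI (Finset.mem_product.1 (Finset.mem_filter.1 hq').1).1

theorem card_filter_insert_right {j : Fin m} {I R : Finset (Fin m)} (hR : j ∉ R) :
    ((I ×ˢ insert j R).filter (fun q => q.2 < q.1)).card =
      ((I ×ˢ R).filter (fun q => q.2 < q.1)).card + (I.filter (j < ·)).card := by
  rw [Finset.insert_eq, Finset.product_union, Finset.product_singleton, Finset.filter_union,
    Finset.card_union_of_disjoint, add_comm]
  · congr 1
    rw [Finset.filter_map, Finset.card_map]
    rfl
  · rw [Finset.disjoint_left]
    intro q hq hq'
    obtain ⟨r, -, rfl⟩ := Finset.mem_map.1 (Finset.mem_filter.1 hq).1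
    exact hR (Finset.mem_product.1 (Finset.mem_filter.1 hq').1).2

theorem card_filter_lt_add_card_filter_gt {j : Fin m} {I : Finset (Fin m)} (hI : j ∉ I) :
    (I.filter (· < j)).card + (I.filter (j < ·)).card = I.card := by
  rw [← Finset.card_filter_add_card_filter_not (s := I) (· < j)]
  congr 2
  refine Finset.filter_congr fun k hk => ?_
  rw [not_lt]
  exact ⟨le_of_lt, fun h => lt_of_le_of_ne h fun h => hI (h ▸ hk)⟩

/-- The left derivative `∂/∂ξʲ`. -/
def pd (j : Fin m) (A : Grassmann m) : Grassmann m := fun I =>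
  if j ∈ I then 0 else (-1 : ℝ) ^ (I.filter (fun k => k < j)).card * A (insert j I)

/-- The two summands correspond to `j` lying in the right or in the left factor of a splitting of
`insert j K`. -/
theorem mul_apply_insert (A B : Grassmann m) {j : Fin m} {K : Finset (Fin m)} (hK : j ∉ K) :
    mul A B (insert j K) = ∑ I ∈ K.powerset,
      ((-1 : ℝ) ^ ((I ×ˢ (K \ I)).filter (fun q => q.2 < q.1)).card *
          (-1) ^ (I.filter (j < ·)).card * A I * B (insert j (K \ I)) +
        (-1 : ℝ) ^ ((I ×ˢ (K \ I)).filter (fun q => q.2 < q.1)).card *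
          (-1) ^ ((K \ I).filter (· < j)).card * A (insert j I) * B (K \ I)) := by
  rw [mul, Finset.sum_powerset_insert hK, ← Finset.sum_add_distrib]
  refine Finset.sum_congr rfl fun I hI => ?_
  have hjI : j ∉ I := fun h => hK (Finset.mem_powerset.1 hI h)
  have hjR : j ∉ K \ I := fun h => hK (Finset.mem_sdiff.1 h).1
  have h₁ : insert j K \ I = insert j (K \ I) := Finset.insert_sdiff_of_notMem _ hjI
  have h₂ : insert j K \ insert j I = K \ I := by
    rw [Finset.insert_sdiff_insert, Finset.sdiff_insert_of_notMem hK]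
  rw [h₁, h₂, card_filter_insert_left hjI, card_filter_insert_right hjR, pow_add, pow_add]

/-- Homogeneity of `A` is used only to replace (-1)^{|I|} by `sgn a` on its coefficients; |I| counts
the indices below and above `j`, matching the signs of ∂/∂ξʲ and of the reordering. -/
theorem pd_mul (j : Fin m) {a : ZMod 2} {A : Grassmann m}
    (hA : ∀ I : Finset (Fin m), (I.card : ZMod 2) ≠ a → A I = 0) (B : Grassmann m) :
    pd j (mul A B) = mul (pd j A) B + sgn a • mul A (pd j B) := by
  have hA' : ∀ I : Finset (Fin m), (-1 : ℝ) ^ I.card * A I = sgn a * A I := by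
    intro I
    by_cases h : (I.card : ZMod 2) = a
    · rw [neg_one_pow_eq_sgn h]
    · rw [hA I h, mul_zero, mul_zero]
  have hsq : ∀ k : ℕ, (-1 : ℝ) ^ k * (-1) ^ k = 1 := fun k => by
    rw [← mul_pow, neg_one_mul, neg_neg, one_pow]
  funext K
  by_cases hK : j ∈ K
  · obtain ⟨L, hL, rfl⟩ : ∃ L, j ∉ L ∧ K = insert j L :=
      ⟨K.erase j, Finset.notMem_erase j K, (Finset.insert_erase hK).symm⟩
    rw [Pi.add_apply, Pi.smul_apply, mul_apply_insert _ _ hL, mul_apply_insert _ _ hL, smul_eq_mul,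
      Finset.mul_sum, ← Finset.sum_add_distrib]
    rw [pd, if_pos hK]
    -- The left side has no ξʲ. On the right, the terms with ξʲ surviving in the left and in the
    -- right factor cancel for each `I`.
    refine (Finset.sum_eq_zero fun I hI => ?_).symm
    have hjI : j ∉ I := fun h => hL (Finset.mem_powerset.1 hI h)
    have hjR : j ∉ L \ I := fun h => hL (Finset.mem_sdiff.1 h).1
    have h := hA' (insert j I)
    rw [Finset.card_insert_of_notMem hjI, pow_succ,
      ← card_filter_lt_add_card_filter_gt hjI, pow_add] at h
    simp only [pd, hjI, hjR, if_false, Finset.mem_insert_self, if_true]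
    linear_combination (-(-1 : ℝ) ^ ((I ×ˢ (L \ I)).filter (fun q => q.2 < q.1)).card *
      B (insert j (L \ I))) * h + (sgn a * (-1 : ℝ) ^ ((I ×ˢ (L \ I)).filter
        (fun q => q.2 < q.1)).card * A (insert j I) * B (insert j (L \ I))) *
          hsq ((L \ I).filter (· < j)).card
  · rw [pd, if_neg hK, mul_apply_insert _ _ hK, Pi.add_apply, Pi.smul_apply, mul, mul, smul_eq_mul,
      Finset.mul_sum, Finset.mul_sum, ← Finset.sum_add_distrib]
    refine Finset.sum_congr rfl fun I hI => ?_
    have hI' := Finset.mem_powerset.1 hI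
    have hjI : j ∉ I := fun h => hK (hI' h)
    have hjR : j ∉ K \ I := fun h => hK (Finset.mem_sdiff.1 h).1
    have h := hA' I
    rw [← card_filter_lt_add_card_filter_gt hjI, pow_add] at h
    have hcard : (K.filter (· < j)).card =
        (I.filter (· < j)).card + ((K \ I).filter (· < j)).card := by
      rw [← Finset.card_union_of_disjoint (Finset.disjoint_filter_filter Finset.disjoint_sdiff),
        ← Finset.filter_union, Finset.union_sdiff_of_subset hI']
    simp only [pd, hjI, hjR, if_false]
    rw [hcard, pow_add]
    linear_combination ((-1 : ℝ) ^ ((I ×ˢ (K \ I)).filter (fun q => q.2 < q.1)).card *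
      (-1) ^ ((K \ I).filter (· < j)).card * B (insert j (K \ I))) * h +
      ((-1 : ℝ) ^ ((I ×ˢ (K \ I)).filter (fun q => q.2 < q.1)).card *
        (-1) ^ (I.filter (· < j)).card * A (insert j I) * B (K \ I)) *
          hsq ((K \ I).filter (· < j)).card

/-- Inserting the smaller of the two indices raises by one the count of indices below the larger
one, and the opposite insertion changes nothing. -/
theorem pd_pd (i j : Fin m) (A : Grassmann m) : pd i (pd j A) = -pd j (pd i A) := by
  funext K
  rw [Pi.neg_apply]
  simp only [pd, Finset.mem_insert]
  by_cases hi : i ∈ K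
  · simp [hi]
  by_cases hj : j ∈ K
  · simp [hj]
  by_cases hij : i = j
  · simp [hij]
  have hf : ∀ {i j : Fin m}, i ∉ K → ((insert i K).filter (· < j)).card =
      (K.filter (· < j)).card + if i < j then 1 else 0 := by
    intro i j hi
    rw [Finset.filter_insert]
    split_ifs with h
    · rw [Finset.card_insert_of_notMem fun h => hi (Finset.mem_filter.1 h).1]
    · rfl
  simp only [hi, hj, hij, Ne.symm hij, or_self, if_false, hf hi, hf hj, Finset.insert_comm j i]
  rcases lt_or_gt_of_ne hij with h | h
  · simp only [h, h.not_gt, if_true, if_false, add_zero, pow_succ]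
    ring
  · simp only [h, h.not_gt, if_true, if_false, add_zero, pow_succ]
    ring

end Grassmann

namespace SuperFun

variable {n m : ℕ} {V : Opens (EuclideanSpace ℝ (Fin n))}

theorem contDiffAt (F : SuperFun n m V) (I : Finset (Fin m)) {x : EuclideanSpace ℝ (Fin n)}
    (hx : x ∈ V) : ContDiffAt ℝ ∞ (fun y => F.1 y I) x :=
  (F.2.1 I).contDiffAt (V.isOpen.mem_nhds hx)

theorem differentiableAt (F : SuperFun n m V) (I : Finset (Fin m)) {x : EuclideanSpace ℝ (Fin n)}
    (hx : x ∈ V) : DifferentiableAt ℝ (fun y => F.1 y I) x :=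
  (contDiffAt F I hx).differentiableAt (by simp)

theorem ext_on {F G : SuperFun n m V} (h : ∀ x ∈ V, F.1 x = G.1 x) : F = G := by
  refine Subtype.ext (funext fun x => ?_)
  by_cases hx : x ∈ V
  · exact h x hx
  · rw [F.2.2 x hx, G.2.2 x hx]

theorem pd_inl_apply (i : Fin n) (F : SuperFun n m V) {x : EuclideanSpace ℝ (Fin n)} (hx : x ∈ V)
    (I : Finset (Fin m)) : (pd (Sum.inl i) F).1 x I =
      fderiv ℝ (fun y => F.1 y I) x (EuclideanSpace.single i 1) :=
  if_pos hx

theorem pd_inr_apply (j : Fin m) (F : SuperFun n m V) (x : EuclideanSpace ℝ (Fin n)) :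
    (pd (Sum.inr j) F).1 x = Grassmann.pd j (F.1 x) := rfl

theorem pd_add (i : Idx n m) (F G : SuperFun n m V) : pd i (F + G) = pd i F + pd i G := by
  refine ext_on fun x hx => funext fun I => ?_
  rcases i with i | j
  · change _ = (pd (Sum.inl i) F).1 x I + (pd (Sum.inl i) G).1 x I
    rw [pd_inl_apply i _ hx, pd_inl_apply i _ hx, pd_inl_apply i _ hx]
    change fderiv ℝ (fun y => F.1 y I + G.1 y I) x _ = _
    rw [fderiv_fun_add (differentiableAt F I hx) (differentiableAt G I hx)]
    rfl
  · change Grassmann.pd j (F.1 x + G.1 x) I = Grassmann.pd j (F.1 x) I + Grassmann.pd j (G.1 x) I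
    simp only [Grassmann.pd, Pi.add_apply]
    split_ifs <;> ring

theorem pd_smul (i : Idx n m) (r : ℝ) (F : SuperFun n m V) : pd i (r • F) = r • pd i F := by
  refine ext_on fun x hx => funext fun I => ?_
  rcases i with i | j
  · change _ = r * (pd (Sum.inl i) F).1 x I
    rw [pd_inl_apply i _ hx, pd_inl_apply i _ hx]
    change fderiv ℝ (fun y => r * F.1 y I) x _ = _
    rw [fderiv_const_mul (differentiableAt F I hx)]
    rfl
  · change Grassmann.pd j (r • F.1 x) I = r * Grassmann.pd j (F.1 x) I
    simp only [Grassmann.pd, Pi.smul_apply, smul_eq_mul]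
    split_ifs <;> ring

theorem pd_congr {V' : Opens (EuclideanSpace ℝ (Fin n))} (hV : V' ≤ V) (i : Idx n m)
    {F : SuperFun n m V} {F' : SuperFun n m V'} (h : ∀ x ∈ V', F'.1 x = F.1 x) :
    ∀ x ∈ V', (pd i F').1 x = (pd i F).1 x := by
  intro x hx
  rcases i with i | j
  · funext I
    rw [pd_inl_apply i _ hx, pd_inl_apply i _ (hV hx)]
    congr 1
    refine Filter.EventuallyEq.fderiv_eq ?_
    filter_upwards [V'.isOpen.mem_nhds hx] with y hy
    rw [h y hy]
  · rw [pd_inr_apply, pd_inr_apply, h x hx]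

theorem pd_parity (i : Idx n m) {a : ZMod 2} {F : SuperFun n m V}
    (hF : ∀ x (I : Finset (Fin m)), (I.card : ZMod 2) ≠ a → F.1 x I = 0)
    (x : EuclideanSpace ℝ (Fin n)) (I : Finset (Fin m)) (hI : (I.card : ZMod 2) ≠ par i + a) :
    (pd i F).1 x I = 0 := by
  by_cases hx : x ∈ V
  · rcases i with i | j
    · rw [pd_inl_apply i _ hx, show (fun y => F.1 y I) = fun _ => 0 from
        funext fun y => hF y I (by simpa [par] using hI)]
      simp
    · rw [pd_inr_apply, Grassmann.pd]
      split_ifs with hj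
      · rfl
      · rw [hF, mul_zero]
        rw [Finset.card_insert_of_notMem hj]
        rintro rfl
        refine hI ?_
        rw [show par (Sum.inr j : Idx n m) = 1 from rfl, Nat.cast_succ, add_left_comm,
          zmod_two_one_add_one, add_zero]
  · rw [(pd i F).2.2 x hx]
    rfl

theorem pd_mul (i : Idx n m) {a : ZMod 2} {F G H : SuperFun n m V}
    (hF : ∀ x (I : Finset (Fin m)), (I.card : ZMod 2) ≠ a → F.1 x I = 0)
    (hH : ∀ x, H.1 x = Grassmann.mul (F.1 x) (G.1 x)) {x : EuclideanSpace ℝ (Fin n)}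
    (hx : x ∈ V) : (pd i H).1 x = Grassmann.mul ((pd i F).1 x) (G.1 x) +
      sgn (par i * a) • Grassmann.mul (F.1 x) ((pd i G).1 x) := by
  rcases i with i | j
  · funext I
    rw [pd_inl_apply i _ hx, show par (Sum.inl i : Idx n m) = 0 from rfl, zero_mul, sgn_zero,
      one_smul, Pi.add_apply]
    simp only [hH, Grassmann.mul, pd_inl_apply i _ hx]
    have h : HasFDerivAt (fun y => ∑ J ∈ I.powerset,
        (-1 : ℝ) ^ ((J ×ˢ (I \ J)).filter (fun q => q.2 < q.1)).card * F.1 y J * G.1 y (I \ J)) _ x :=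
      HasFDerivAt.fun_sum fun J _ =>
        (((differentiableAt F J hx).hasFDerivAt.const_mul
          ((-1 : ℝ) ^ ((J ×ˢ (I \ J)).filter (fun q => q.2 < q.1)).card)).mul
            (differentiableAt G (I \ J) hx).hasFDerivAt)
    rw [h.fderiv, _root_.sum_apply, ← Finset.sum_add_distrib]
    refine Finset.sum_congr rfl fun J _ => ?_
    simp only [_root_.add_apply, _root_.smul_apply, smul_eq_mul]
    ring
  · rw [pd_inr_apply, pd_inr_apply, pd_inr_apply, hH, Grassmann.pd_mul j (hF x),
      show par (Sum.inr j : Idx n m) = 1 from rfl, one_mul]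

theorem pd_inl_inr_comm (i : Fin n) (j : Fin m) (F : SuperFun n m V) :
    pd (Sum.inl i) (pd (Sum.inr j) F) = pd (Sum.inr j) (pd (Sum.inl i) F) := by
  refine ext_on fun x hx => funext fun I => ?_
  rw [pd_inl_apply i _ hx, pd_inr_apply]
  simp only [pd_inr_apply, Grassmann.pd]
  split_ifs with hj
  · simp
  · rw [fderiv_const_mul (differentiableAt F _ hx), pd_inl_apply i _ hx]
    rfl

theorem pd_comm (i j : Idx n m) (F : SuperFun n m V) :
    pd i (pd j F) = sgn (par i * par j) • pd j (pd i F) := by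
  rcases i with i | i <;> rcases j with j | j
  · refine ext_on fun x hx => funext fun I => ?_
    have h : ∀ k l : Fin n, (pd (Sum.inl k) (pd (Sum.inl l) F)).1 x I =
        fderiv ℝ (fderiv ℝ fun y => F.1 y I) x (EuclideanSpace.single k 1)
          (EuclideanSpace.single l 1) := by
      intro k l
      rw [pd_inl_apply k _ hx]
      have hd : DifferentiableAt ℝ (fderiv ℝ fun y => F.1 y I) x :=
        ((contDiffAt F I hx).fderiv_right (m := 1) (by norm_cast)).differentiableAt
          one_ne_zero
      rw [Filter.EventuallyEq.fderiv_eq (f := fun y => fderiv ℝ (fun y => F.1 y I) y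
        (EuclideanSpace.single l 1)), fderiv_clm_apply hd (differentiableAt_const _)]
      · simp
      · filter_upwards [V.isOpen.mem_nhds hx] with y hy
        rw [pd_inl_apply l _ hy]
    rw [show par (Sum.inl i : Idx n m) = 0 from rfl, zero_mul, sgn_zero, one_smul, h, h]
    -- Symmetry of the second derivative of each coefficient.
    exact ((contDiffAt F I hx).isSymmSndFDerivAt (by
      rw [minSmoothness_of_isRCLikeNormedField]
      exact ENat.LEInfty.out)).eq _ _
  · rw [show par (Sum.inl i : Idx n m) = 0 from rfl, zero_mul, sgn_zero, one_smul,
      pd_inl_inr_comm]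
  · rw [show par (Sum.inl j : Idx n m) = 0 from rfl, mul_zero, sgn_zero, one_smul,
      pd_inl_inr_comm]
  · refine ext_on fun x _ => ?_
    rw [show par (Sum.inr i : Idx n m) = 1 from rfl, show par (Sum.inr j : Idx n m) = 1 from rfl,
      one_mul, sgn_one]
    change _ = (-1 : ℝ) • Grassmann.pd j (Grassmann.pd i (F.1 x))
    rw [neg_one_smul]
    exact Grassmann.pd_pd i j (F.1 x)

theorem coord_parity (i : Idx n m) (x : EuclideanSpace ℝ (Fin n)) (I : Finset (Fin m))
    (hI : (I.card : ZMod 2) ≠ par i) : (coord (V := V) i).1 x I = 0 := by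
  rcases i with i | j
  · refine if_neg fun h => hI ?_
    rw [h.2]
    rfl
  · refine if_neg fun h => hI ?_
    rw [h.2]
    rfl

theorem pd_coord (i j : Idx n m) {x : EuclideanSpace ℝ (Fin n)} (hx : x ∈ V) :
    (pd i (coord (V := V) j)).1 x = if i = j then Grassmann.one else 0 := by
  funext I
  rcases i with i | i <;> rcases j with j | j
  · have h : (fun y => (coord (V := V) (Sum.inl j : Idx n m)).1 y I) =ᶠ[nhds x]
        fun y => if I = ∅ then y j else 0 := by
      filter_upwards [V.isOpen.mem_nhds hx] with y hy
      simp [coord, SetLike.mem_coe.1 hy]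
    rw [pd_inl_apply i _ hx, h.fderiv_eq]
    by_cases hI : I = ∅
    · have hd : HasFDerivAt (fun y : EuclideanSpace ℝ (Fin n) => y j)
          (EuclideanSpace.proj j : EuclideanSpace ℝ (Fin n) →L[ℝ] ℝ) x :=
        (EuclideanSpace.proj j : EuclideanSpace ℝ (Fin n) →L[ℝ] ℝ).hasFDerivAt
      simp only [hI, if_true, hd.fderiv]
      by_cases hij : i = j
      · simp [hij, Grassmann.one]
      · simp [hij, Ne.symm hij]
    · simp only [hI, if_false, fderiv_fun_const]
      split_ifs
      · simp [Grassmann.one, hI]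
      · simp
  · have h : (fun y => (coord (V := V) (Sum.inr j : Idx n m)).1 y I) =ᶠ[nhds x]
        fun y => if I = {j} then 1 else 0 := by
      filter_upwards [V.isOpen.mem_nhds hx] with y hy
      simp [coord, SetLike.mem_coe.1 hy]
    rw [pd_inl_apply i _ hx, h.fderiv_eq]
    simp
  · rw [pd_inr_apply]
    simp [Grassmann.pd, coord]
  · rw [pd_inr_apply]
    by_cases hi : i ∈ I
    · have hI : I ≠ ∅ := Finset.ne_empty_of_mem hi
      by_cases hij : i = j <;> simp [Grassmann.pd, hi, hij, Grassmann.one, hI]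
      intro h
      exact absurd (hij ▸ hi) h
    · by_cases hI : I = ∅
      · subst hI
        by_cases hij : i = j
        · simp [Grassmann.pd, coord, hij, hx, Grassmann.one]
        · simp [Grassmann.pd, coord, hij, hx]
      · have h : insert i I ≠ {j} := by
          intro h
          obtain ⟨k, hk⟩ := Finset.nonempty_iff_ne_empty.2 hI
          have h₁ := h ▸ Finset.mem_insert_self i I
          have h₂ := h ▸ Finset.mem_insert_of_mem (a := k) (b := i) hk
          rw [Finset.mem_singleton] at h₁ h₂
          exact hi (h₁.trans h₂.symm ▸ hk)
        by_cases hij : i = j <;> simp [Grassmann.pd, coord, hi, hij, h, Grassmann.one, hI]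
        intro _ _ h'
        exact absurd (hij ▸ h') h

/-- The product of a superfunction with a smooth function on `ℝⁿ`. -/
noncomputable def mulSmooth (χ : EuclideanSpace ℝ (Fin n) → ℝ) (hχ : ContDiff ℝ ∞ χ)
    (F : SuperFun n m V) : SuperFun n m V :=
  ⟨fun x => χ x • F.1 x, fun I => hχ.contDiffOn.mul (F.2.1 I),
    fun x hx => (congrArg (χ x • ·) (F.2.2 x hx)).trans (smul_zero _)⟩

end SuperFun

/-! ### Restriction of sections, charts as coordinate systems, and extension to global functions. -/

namespace SuperSpace

theorem isSuperalgebra (X : SuperSpace.{u}) (U : Opens X.carrier) : IsSuperalgebra (X.gr U) :=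
  ⟨X.isInternal U, X.gradedMonoid U, X.supercomm U⟩

theorem res_res (X : SuperSpace.{u}) {U V W : Opens X.carrier} (h : V ≤ U) (h' : W ≤ V)
    (f : X.Sec U) : X.res h' (X.res h f) = X.res (h'.trans h) f := by
  change (X.sheaf.1.map (homOfLE h').op).hom ((X.sheaf.1.map (homOfLE h).op).hom f) =
    (X.sheaf.1.map (homOfLE (h'.trans h)).op).hom f
  rw [← homOfLE_comp h' h, op_comp, X.sheaf.1.map_comp]
  rfl

theorem res_eq_res_of_le (X : SuperSpace.{u}) {U V W : Opens X.carrier} (h : V ≤ U) (h' : W ≤ V)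
    {f g : X.Sec U} (hfg : X.res h f = X.res h g) : X.res (h'.trans h) f = X.res (h'.trans h) g := by
  rw [← X.res_res h h', hfg, X.res_res]

theorem res_mem_gr (X : SuperSpace.{u}) {U V : Opens X.carrier} (h : V ≤ U) {a : ZMod 2} {f : X.Sec U}
    (hf : f ∈ X.gr U a) : X.res h f ∈ X.gr V a :=
  SuperSpace.res_mem X h a f hf

end SuperSpace

namespace SuperChart

variable {X : SuperSpace.{u}} {n m : ℕ} (c : SuperChart X n m)

theorem ext_sec {W : Opens X.carrier} (h : (W : Set X.carrier) ⊆ c.body.source) {f g : X.Sec W}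
    (hfg : ∀ x ∈ imageOpens c.body W h, (c.iso W h f).1 x = (c.iso W h g).1 x) : f = g :=
  (c.iso W h).injective (SuperFun.ext_on hfg)

theorem iso_pd {W : Opens X.carrier} (h : W ≤ c.dom) (i : Idx n m) (f : X.Sec W) :
    c.iso W h (c.pd h i f) = SuperFun.pd i (c.iso W h f) :=
  (c.iso W h).apply_symm_apply _

theorem res_pd {W W' : Opens X.carrier} (h : W ≤ c.dom) (hW : W' ≤ W) (i : Idx n m)
    (f : X.Sec W) : X.res hW (c.pd h i f) = c.pd (hW.trans h) i (X.res hW f) := by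
  refine c.ext_sec (hW.trans h) fun x hx => ?_
  rw [c.iso_res W W' h hW _ x hx, iso_pd, iso_pd]
  exact (SuperFun.pd_congr (Set.image_mono hW) i (c.iso_res W W' h hW f) x hx).symm

/-- The coordinates and the partial derivatives of a chart. -/
noncomputable def coords : SuperCoords (X.gr c.dom) (par (n := n) (m := m)) where
  d i :=
    { toFun := c.D i
      map_add' := fun f g => by simp only [D, pd, map_add, SuperFun.pd_add]
      map_smul' := fun r f => by simp only [D, pd, map_smul, SuperFun.pd_smul, RingHom.id_apply] }
  x := c.coord (le_refl c.dom)
  d_mem i a f hf := by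
    refine (c.iso_parity c.dom (le_refl c.dom) _ _).2 ?_
    change ∀ x I, _ → (c.iso c.dom (le_refl c.dom) (c.pd (le_refl c.dom) i f)).1 x I = 0
    rw [iso_pd]
    exact SuperFun.pd_parity i ((c.iso_parity c.dom (le_refl c.dom) a f).1 hf)
  x_mem i := by
    refine (c.iso_parity c.dom (le_refl c.dom) _ _).2 ?_
    rw [coord, LinearEquiv.apply_symm_apply]
    exact SuperFun.coord_parity i
  leibniz i a f hf g := by
    refine c.ext_sec (le_refl c.dom) fun x hx => ?_
    change (c.iso c.dom (le_refl c.dom) (c.pd (le_refl c.dom) i (f * g))).1 x = (c.iso c.dom (le_refl c.dom)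
      (c.pd (le_refl c.dom) i f * g + sgn (par i * a) • (f * c.pd (le_refl c.dom) i g))).1 x
    rw [map_add, map_smul]
    change _ = (c.iso c.dom (le_refl c.dom) (c.pd (le_refl c.dom) i f * g)).1 x +
      sgn (par i * a) • (c.iso c.dom (le_refl c.dom) (f * c.pd (le_refl c.dom) i g)).1 x
    have h₁ := c.iso_mul c.dom (le_refl c.dom) (c.pd (le_refl c.dom) i f) g x
    have h₂ := c.iso_mul c.dom (le_refl c.dom) f (c.pd (le_refl c.dom) i g) x
    rw [iso_pd] at h₁ h₂
    rw [iso_pd]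
    exact (SuperFun.pd_mul i ((c.iso_parity c.dom (le_refl c.dom) a f).1 hf)
      (c.iso_mul _ _ f g) hx).trans
        (congrArg₂ (fun u v => u + sgn (par i * a) • v) h₁.symm h₂.symm)
  comm i j f := by
    refine (c.iso c.dom (le_refl c.dom)).injective ?_
    rw [map_smul]
    change c.iso c.dom (le_refl c.dom) (c.pd (le_refl c.dom) i (c.pd (le_refl c.dom) j f)) =
      sgn (par i * par j) • c.iso c.dom (le_refl c.dom) (c.pd (le_refl c.dom) j (c.pd (le_refl c.dom) i f))
    rw [iso_pd, iso_pd, iso_pd, iso_pd, SuperFun.pd_comm]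
  d_x i j := by
    refine c.ext_sec (le_refl c.dom) fun x hx => ?_
    change (c.iso c.dom (le_refl c.dom) (c.pd (le_refl c.dom) i (c.coord (le_refl c.dom) j))).1 x = _
    rw [iso_pd, coord, LinearEquiv.apply_symm_apply, SuperFun.pd_coord i j hx]
    split_ifs
    · exact (c.iso_one _ _ x hx).symm
    · rw [map_zero]
      rfl

theorem res_d_congr {W : Opens X.carrier} (hW : W ≤ c.dom) (i : Idx n m) {f g : X.Sec c.dom}
    (h : X.res hW f = X.res hW g) : X.res hW (c.coords.d i f) = X.res hW (c.coords.d i g) := by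
  change X.res hW (c.pd le_rfl i f) = X.res hW (c.pd le_rfl i g)
  rw [res_pd, res_pd, h]

theorem res_lap_congr {W : Opens X.carrier} (hW : W ≤ c.dom) (S : Idx n m → Idx n m → X.Sec c.dom)
    (T : Idx n m → X.Sec c.dom) {f g : X.Sec c.dom} (h : X.res hW f = X.res hW g) :
    X.res hW (c.coords.lap S T f) = X.res hW (c.coords.lap S T g) := by
  rw [SuperCoords.lap_apply, SuperCoords.lap_apply]
  simp only [map_add, map_sum, map_mul]
  congr 1
  · refine Finset.sum_congr rfl fun i _ => Finset.sum_congr rfl fun j _ => ?_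
    rw [c.res_d_congr hW j (c.res_d_congr hW i h)]
  · exact Finset.sum_congr rfl fun i _ => by rw [c.res_d_congr hW i h]

theorem eq_of_locally_eq {f g : X.Sec c.dom} (h : ∀ p ∈ c.dom, ∃ (W : Opens X.carrier)
    (hW : W ≤ c.dom), p ∈ W ∧ X.res hW f = X.res hW g) : f = g := by
  refine c.ext_sec le_rfl fun x hx => ?_
  obtain ⟨p, hp, rfl⟩ := hx
  obtain ⟨W, hW, hpW, h⟩ := h p hp
  have hx : c.body p ∈ imageOpens c.body W hW := ⟨p, hpW, rfl⟩
  rw [← c.iso_res c.dom W le_rfl hW f _ hx, ← c.iso_res c.dom W le_rfl hW g _ hx, h]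

/-- A section over the domain of a chart agrees near any given point with a global section. -/
theorem exists_global [T2Space X.carrier] (s : X.Sec c.dom) {p : X.carrier} (hp : p ∈ c.dom) :
    ∃ (f : X.Sec ⊤) (W : Opens X.carrier) (hW : W ≤ c.dom), p ∈ W ∧
      X.res hW (X.res le_top f) = X.res hW s := by
  obtain ⟨r, hr, hrt⟩ := Metric.nhds_basis_closedBall.mem_iff.1
    (c.body.open_target.mem_nhds (c.body.map_source hp))
  let χ : ContDiffBump (c.body p) := ⟨r / 2, r, half_pos hr, half_lt_self hr⟩
  let K : Set X.carrier := c.body.symm '' Metric.closedBall (c.body p) r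
  -- Compact subsets are closed because the space is Hausdorff; without this, extension by zero
  -- could fail.
  have hK : IsClosed K := ((isCompact_closedBall _ _).image_of_continuousOn
    (c.body.continuousOn_symm.mono hrt)).isClosed
  let N : Opens X.carrier := ⟨Kᶜ, hK.isOpen_compl⟩
  let t : X.Sec c.dom := (c.iso c.dom le_rfl).symm
    (SuperFun.mulSmooth χ χ.contDiff (c.iso c.dom le_rfl s))
  have ht : ∀ x, (c.iso c.dom le_rfl t).1 x = χ x • (c.iso c.dom le_rfl s).1 x := fun x => by
    rw [LinearEquiv.apply_symm_apply]
    rfl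
  have htN : ∀ (Z : Opens X.carrier) (hZ : Z ≤ c.dom), Z ≤ N → X.res hZ t = 0 := by
    intro Z hZ hZN
    refine c.ext_sec hZ fun x hx => ?_
    rw [c.iso_res c.dom Z le_rfl hZ t x hx, ht, map_zero]
    obtain ⟨q, hq, rfl⟩ := hx
    have hχ : χ (c.body q) = 0 := by
      refine χ.zero_of_le_dist (le_of_not_gt fun h => hZN hq ?_)
      exact ⟨c.body q, Metric.mem_closedBall.2 h.le, c.body.left_inv (hZ hq)⟩
    rw [hχ, zero_smul]
    rfl
  -- The cut-off section on the chart and zero on the complement of `K` are glued; they agree on the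
  -- overlap by `htN`.
  let U : Bool → Opens X.carrier := fun b => if b then c.dom else N
  let sf : ∀ b, ToType (X.sheaf.1.obj (op (U b))) := fun b => match b with
    | true => t
    | false => (0 : X.Sec N)
  have hcover : (⊤ : Opens X.carrier) ≤ iSup U := by
    intro q _
    rw [Opens.mem_iSup]
    by_cases hq : q ∈ K
    · obtain ⟨y, hy, rfl⟩ := hq
      exact ⟨true, c.body.map_target (hrt hy)⟩
    · exact ⟨false, hq⟩
  obtain ⟨f, hf, -⟩ := X.sheaf.existsUnique_gluing' U ⊤ (fun b => homOfLE le_top) hcover sf (by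
    intro b b'
    match b, b' with
    | true, true => rfl
    | false, false => rfl
    | true, false =>
      refine (htN (c.dom ⊓ N) inf_le_left inf_le_right).trans ?_
      exact (map_zero (X.res (inf_le_right : c.dom ⊓ N ≤ N))).symm
    | false, true =>
      refine Eq.trans ?_ (htN (N ⊓ c.dom) inf_le_right inf_le_left).symm
      exact map_zero (X.res (inf_le_left : N ⊓ c.dom ≤ N)))
  have hft : X.res le_top f = t := hf true
  -- The inner ball, where the bump function equals 1.
  let W : Opens X.carrier := ⟨c.body.source ∩ c.body ⁻¹' Metric.ball (c.body p) (r / 2),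
    c.body.isOpen_inter_preimage Metric.isOpen_ball⟩
  have hW : W ≤ c.dom := fun q hq => hq.1
  refine ⟨f, W, hW, ⟨hp, Metric.mem_ball_self (half_pos hr)⟩, ?_⟩
  rw [hft]
  refine c.ext_sec hW fun x hx => ?_
  rw [c.iso_res c.dom W le_rfl hW t x hx, c.iso_res c.dom W le_rfl hW s x hx, ht]
  obtain ⟨q, hq, rfl⟩ := hx
  rw [χ.one_of_mem_closedBall (Metric.ball_subset_closedBall hq.2), one_smul]

/-- The component of parity `a` of a global extension suffices: near `p` the other component equals
a difference of parity `a`, hence vanishes. -/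
theorem exists_global_mem [T2Space X.carrier] {a : ZMod 2} {s : X.Sec c.dom}
    (hs : s ∈ X.gr c.dom a) {p : X.carrier} (hp : p ∈ c.dom) :
    ∃ f ∈ X.gr ⊤ a, ∃ (W : Opens X.carrier) (hW : W ≤ c.dom), p ∈ W ∧
      X.res hW (X.res le_top f) = X.res hW s := by
  obtain ⟨f, W, hW, hpW, h⟩ := c.exists_global s hp
  obtain ⟨f₀, hf₀, f₁, hf₁, rfl⟩ := (X.isSuperalgebra ⊤).exists_add a f
  refine ⟨f₀, hf₀, W, hW, hpW, ?_⟩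
  rw [map_add, map_add] at h
  refine sub_eq_zero.1 ((X.isSuperalgebra W).eq_zero_of_mem_of_mem (a := a)
    (sub_mem (X.res_mem_gr hW (X.res_mem_gr le_top hf₀)) (X.res_mem_gr hW hs)) ?_)
  rw [← h, sub_add_cancel_left]
  exact neg_mem (X.res_mem_gr hW (X.res_mem_gr le_top hf₁))

end SuperChart

/-! ### Global functions are determined by their restrictions to charts. -/

namespace Supermanifold

variable {n m : ℕ} (M : Supermanifold.{u} n m)

theorem ext_toLoc {f g : M.Fun} (h : ∀ c, M.toLoc c f = M.toLoc c g) : f = g := by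
  refine M.sheaf.eq_of_locally_eq' (fun c => (M.chart c).dom) ⊤ (fun c => homOfLE le_top) ?_ f g h
  intro p _
  rw [Opens.mem_iSup]
  exact M.cover p

/-- The component of the opposite parity vanishes in every chart, hence globally. -/
theorem mem_gr_of_toLoc {a : ZMod 2} {f : M.Fun} (h : ∀ c, M.toLoc c f ∈ M.gr _ a) :
    f ∈ M.gr ⊤ a := by
  obtain ⟨f₀, hf₀, f₁, hf₁, rfl⟩ := (M.isSuperalgebra ⊤).exists_add a f
  have hz : f₁ = 0 := by
    refine M.ext_toLoc fun c => ?_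
    rw [map_zero]
    refine (M.isSuperalgebra _).eq_zero_of_mem_of_mem (a := a) ?_ (M.res_mem_gr le_top hf₁)
    have h' := sub_mem (h c) (M.res_mem_gr (le_top : (M.chart c).dom ≤ ⊤) hf₀)
    change M.toLoc c (f₀ + f₁) - M.toLoc c f₀ ∈ _ at h'
    rwa [map_add, add_sub_cancel_left] at h'
  rw [hz, add_zero]
  exact hf₀

end Supermanifold

/-! ### The projective Laplacian -/

variable {n m : ℕ} {M : Supermanifold.{u} n m}

theorem tracefree_mem (Γ : Connection M) (c : M.ι) (j i k : Idx n m) :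
    tracefree Γ c j i k ∈ M.gr _ (par j + par i + par k) := by
  refine sub_mem (Γ.parity c j i k) (Submodule.smul_mem _ _ (add_mem ?_ ?_))
  · split_ifs with h
    · subst h
      refine sum_mem fun s _ => Submodule.smul_mem _ _ ?_
      have h := Γ.parity c j s s
      rwa [add_assoc, CharTwo.add_self_eq_zero, ← CharTwo.add_self_eq_zero (par k), ← add_assoc] at h
    · exact zero_mem _
  · split_ifs with h
    · subst h
      refine sum_mem fun s _ => Submodule.smul_mem _ _ ?_
      have h := Γ.parity c i s s
      rwa [add_assoc, CharTwo.add_self_eq_zero, add_comm, ← CharTwo.add_self_eq_zero (par k),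
        add_right_comm] at h
    · exact zero_mem _

theorem ProjectiveClass.coeff_mem (P : ProjectiveClass M) (c : M.ι) (j i k : Idx n m) :
    P.coeff c j i k ∈ M.gr _ (par j + par i + par k) := by
  induction P using Quotient.inductionOn with
  | h Γ => exact tracefree_mem Γ c j i k

theorem Tvec_mem (P : ProjectiveClass M) (S : OddTensor M) (c : M.ι) (i : Idx n m) :
    Tvec P S c i ∈ M.gr _ (par i + 1) := by
  refine sub_mem (Submodule.smul_mem _ _ (sum_mem fun j _ => ?_))
    (Submodule.smul_mem _ _ (sum_mem fun j _ => sum_mem fun k _ => ?_))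
  · have h := (M.chart c).coords.d_mem j _ _ (S.parity c j i)
    rwa [← add_assoc, ← add_assoc, CharTwo.add_self_eq_zero, zero_add] at h
  · have h := (M.isSuperalgebra _).mul_mem (S.parity c j k) (P.coeff_mem c k j i)
    rwa [show par j + par k + 1 + (par k + par j + par i) =
      par i + 1 + (par j + par j) + (par k + par k) by ring, CharTwo.add_self_eq_zero,
      CharTwo.add_self_eq_zero, add_zero, add_zero] at h

/-- The local expression of the projective Laplacian as a differential operator. -/
noncomputable def chartLaplacian (P : ProjectiveClass M) (S : OddTensor M) (c : M.ι) :
    Module.End ℝ (M.Loc c) :=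
  (M.chart c).coords.lap (S.comp c) (Tvec P S c)

theorem chartLaplacian_apply (P : ProjectiveClass M) (S : OddTensor M) (c : M.ι) (f : M.Loc c) :
    chartLaplacian P S c f = localLaplacian P S c f :=
  SuperCoords.lap_apply _ _ _ f

section Laplacian

variable {P : ProjectiveClass M} {S : OddTensor M} {B : M.Fun →ₗ[ℝ] M.Fun →ₗ[ℝ] M.Fun}
  {Δ : M.Fun →ₗ[ℝ] M.Fun}

theorem chartLaplacian_mem (P : ProjectiveClass M) (S : OddTensor M) (c : M.ι) {a : ZMod 2}
    {f : M.Loc c} (hf : f ∈ M.gr _ a) : chartLaplacian P S c f ∈ M.gr _ (a + 1) :=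
  (M.chart c).coords.lap_mem (M.isSuperalgebra _) (S.parity c) (Tvec_mem P S c) hf

theorem IsProjectiveLaplacian.toLoc_apply (hΔ : IsProjectiveLaplacian P S Δ) (c : M.ι)
    (f : M.Fun) : M.toLoc c (Δ f) = chartLaplacian P S c (M.toLoc c f) := by
  rw [chartLaplacian_apply]
  exact hΔ c f

theorem IsProjectiveLaplacian.mem (hΔ : IsProjectiveLaplacian P S Δ) {a : ZMod 2} {f : M.Fun}
    (hf : f ∈ M.gr ⊤ a) : Δ f ∈ M.gr ⊤ (a + 1) :=
  M.mem_gr_of_toLoc fun c => by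
    rw [hΔ.toLoc_apply]
    exact chartLaplacian_mem P S c (M.res_mem_gr le_top hf)

/-- The projective Laplacian generates the bracket. -/
theorem IsProjectiveLaplacian.map_mul (hΔ : IsProjectiveLaplacian P S Δ) (hB : IsBracketOf S B)
    {a : ZMod 2} {f : M.Fun} (hf : f ∈ M.gr ⊤ a) (g : M.Fun) :
    Δ (f * g) = Δ f * g + sgn a • (f * Δ g) + sgn a • B f g := by
  refine M.ext_toLoc fun c => ?_
  simp only [map_add, map_smul, _root_.map_mul, hΔ.toLoc_apply]
  rw [hB c a f g hf, sgn_smul_sgn_smul]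
  exact (M.chart c).coords.lap_mul (M.isSuperalgebra _) (S.parity c) (S.symm c) (Tvec_mem P S c)
    (M.res_mem_gr le_top hf) _

theorem IsProjectiveLaplacian.sq_toLoc (hΔ : IsProjectiveLaplacian P S Δ) (c : M.ι)
    (f : M.Fun) : M.toLoc c (Δ (Δ f)) =
      chartLaplacian P S c (chartLaplacian P S c (M.toLoc c f)) := by
  rw [hΔ.toLoc_apply, hΔ.toLoc_apply]

theorem res_chartLaplacian_sq_congr (P : ProjectiveClass M) (S : OddTensor M) (c : M.ι)
    {W : Opens M.carrier} (hW : W ≤ (M.chart c).dom) {f g : M.Loc c}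
    (h : M.res hW f = M.res hW g) : M.res hW (chartLaplacian P S c (chartLaplacian P S c f)) =
      M.res hW (chartLaplacian P S c (chartLaplacian P S c g)) :=
  (M.chart c).res_lap_congr hW _ _ ((M.chart c).res_lap_congr hW _ _ h)

/-- A section on a chart need not extend globally, but near each point it agrees with a global
function, and Δ² is local. -/
theorem chartLaplacian_sq_eq_zero (hΔ : IsProjectiveLaplacian P S Δ) (hsq : ∀ f, Δ (Δ f) = 0)
    (c : M.ι) (s : M.Loc c) : chartLaplacian P S c (chartLaplacian P S c s) = 0 := by
  have := M.t2
  refine (M.chart c).eq_of_locally_eq fun p hp => ?_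
  obtain ⟨f, W, hW, hpW, h⟩ := (M.chart c).exists_global s hp
  refine ⟨W, hW, hpW, ?_⟩
  have hf := congrArg (M.toLoc c) (hsq f)
  rw [hΔ.sq_toLoc, map_zero] at hf
  rw [← hf]
  exact res_chartLaplacian_sq_congr P S c hW h.symm

/-- In a chart, the square of the projective Laplacian is of order at most two. -/
theorem chartLaplacian_sq_secondOrder (hΔ : IsProjectiveLaplacian P S Δ) (hB : IsBracketOf S B)
    (hPoisson : IsOddPoisson (M.gr ⊤) B) (c : M.ι) {a b : ZMod 2} {x y : M.Loc c}
    (hx : x ∈ M.gr _ a) (hy : y ∈ M.gr _ b) (z : M.Loc c) :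
    let E := chartLaplacian P S c * chartLaplacian P S c
    E (x * (y * z)) - E x * (y * z) - x * E (y * z) =
      (E (x * y) - E x * y - x * E y) * z + sgn (a * b) • (y * (E (x * z) - E x * z - x * E z)) := by
  intro E
  have := M.t2
  refine (M.chart c).eq_of_locally_eq fun p hp => ?_
  obtain ⟨f, hf, W₁, hW₁, hp₁, hxf⟩ := (M.chart c).exists_global_mem hx hp
  obtain ⟨g, hg, W₂, hW₂, hp₂, hyg⟩ := (M.chart c).exists_global_mem hy hp
  obtain ⟨h, W₃, hW₃, hp₃, hzh⟩ := (M.chart c).exists_global z hp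
  -- On this common neighbourhood all three sections come from global functions, where the identity
  -- of `sq_secondOrder` is available.
  have hW : W₁ ⊓ (W₂ ⊓ W₃) ≤ (M.chart c).dom := inf_le_left.trans hW₁
  refine ⟨W₁ ⊓ (W₂ ⊓ W₃), hW, ⟨hp₁, hp₂, hp₃⟩, ?_⟩
  have hx' : M.res hW x = M.res hW (M.toLoc c f) :=
    (M.res_eq_res_of_le hW₁ inf_le_left hxf).symm
  have hy' : M.res hW y = M.res hW (M.toLoc c g) :=
    (M.res_eq_res_of_le hW₂ (inf_le_right.trans inf_le_left) hyg).symm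
  have hz' : M.res hW z = M.res hW (M.toLoc c h) :=
    (M.res_eq_res_of_le hW₃ (inf_le_right.trans inf_le_right) hzh).symm
  have hE : ∀ {s t : M.Loc c}, M.res hW s = M.res hW t → M.res hW (E s) = M.res hW (E t) :=
    fun hst => res_chartLaplacian_sq_congr P S c hW hst
  have hE' : ∀ k, M.toLoc c (Δ (Δ k)) = E (M.toLoc c k) := hΔ.sq_toLoc c
  have key := congrArg (fun k => M.res hW (M.toLoc c k)) (sq_secondOrder hPoisson
    (fun a f hf => hΔ.mem hf) (fun a f g hf => hΔ.map_mul hB hf g) hf hg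
    ((M.isSuperalgebra ⊤).mul_mem hf hg) h)
  simp only [map_add, map_sub, map_smul, map_mul, hE'] at key
  simp only [map_add, map_sub, map_smul, map_mul]
  rw [hE (s := x * (y * z)) (t := M.toLoc c f * (M.toLoc c g * M.toLoc c h))
      (by simp only [map_mul, hx', hy', hz']), hE hx', hE hy', hE hz',
    hE (s := y * z) (t := M.toLoc c g * M.toLoc c h) (by simp only [map_mul, hy', hz']),
    hE (s := x * y) (t := M.toLoc c f * M.toLoc c g) (by simp only [map_mul, hx', hy']),
    hE (s := x * z) (t := M.toLoc c f * M.toLoc c h) (by simp only [map_mul, hx', hz']),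
    hx', hy', hz']
  exact key

theorem chartLaplacian_sq_x_mul_x (P : ProjectiveClass M) (S : OddTensor M) (c : M.ι)
    (i j : Idx n m) :
    chartLaplacian P S c (chartLaplacian P S c ((M.chart c).coords.x i * (M.chart c).coords.x j)) =
      chartLaplacian P S c (Tvec P S c i) * (M.chart c).coords.x j +
      (M.chart c).coords.x i * chartLaplacian P S c (Tvec P S c j) +
      (2 : ℝ) • (chartLaplacian P S c (S.comp c i j) +
        ∑ k, sgn (par i) • (S.comp c i k * (M.chart c).D k (Tvec P S c j)) +
        ∑ k, sgn (par j * (par i + 1)) • (S.comp c j k * (M.chart c).D k (Tvec P S c i))) := by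
  have h := (M.chart c).coords.lap_lap_x_mul_x (M.isSuperalgebra _) (S.parity c) (S.symm c)
    (Tvec_mem P S c) i j
  rw [SuperCoords.lap_x _ (M.isSuperalgebra _), SuperCoords.lap_x _ (M.isSuperalgebra _)] at h
  exact h

end Laplacian

end SuperGeom

/-! ### The equivalence. -/

theorem mainTheorem6 {n m : ℕ} (hdim1 : (n : ℤ) - (m : ℤ) + 1 ≠ 0)
    (hdim3 : (n : ℤ) - (m : ℤ) + 3 ≠ 0)
    (M : SuperGeom.Supermanifold.{u} n m) (P : SuperGeom.ProjectiveClass M)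
    (S : SuperGeom.OddTensor M) (B : M.Fun →ₗ[ℝ] M.Fun →ₗ[ℝ] M.Fun)
    (hB : SuperGeom.IsBracketOf S B) (hPoisson : SuperGeom.IsOddPoisson (M.gr ⊤) B)
    (Δ : M.Fun →ₗ[ℝ] M.Fun) (hΔ : SuperGeom.IsProjectiveLaplacian P S Δ) :
    SuperGeom.IsBVOperator (M.gr ⊤) B Δ ↔
      ∀ c : M.ι,
        (∀ i, (∑ j, ∑ k, S.comp c j k *
              (M.chart c).D k ((M.chart c).D j (SuperGeom.Tvec P S c i))) +
            ∑ j, SuperGeom.Tvec P S c j * (M.chart c).D j (SuperGeom.Tvec P S c i) = 0) ∧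
        (∀ i j, (∑ k, ∑ l, S.comp c k l *
              (M.chart c).D l ((M.chart c).D k (S.comp c i j))) +
            (∑ k, SuperGeom.Tvec P S c k * (M.chart c).D k (S.comp c i j)) +
            (∑ k, SuperGeom.sgn (SuperGeom.par i) •
              (S.comp c i k * (M.chart c).D k (SuperGeom.Tvec P S c j))) +
            (∑ k, SuperGeom.sgn (SuperGeom.par j * (SuperGeom.par i + 1)) •
              (S.comp c j k * (M.chart c).D k (SuperGeom.Tvec P S c i))) = 0) := by
  have hC : ∀ c : M.ι, ∀ i, SuperGeom.chartLaplacian P S c ((M.chart c).coords.x i) =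
      SuperGeom.Tvec P S c i :=
    fun c i => SuperGeom.SuperCoords.lap_x _ (M.isSuperalgebra _) _ _ i
  constructor
  · intro h c
    have hE := SuperGeom.chartLaplacian_sq_eq_zero hΔ h.sq_zero c
    have hT : ∀ i, SuperGeom.chartLaplacian P S c (SuperGeom.Tvec P S c i) = 0 := fun i => by
      rw [← hC, hE]
    refine ⟨fun i => ?_, fun i j => ?_⟩
    · exact (SuperGeom.chartLaplacian_apply P S c _).symm.trans (hT i)
    · have hij := SuperGeom.chartLaplacian_sq_x_mul_x P S c i j
      -- What remains of Δ²(x^i x^j) = 0 is twice the second equation.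
      rw [hE, hT, hT, zero_mul, mul_zero, zero_add, zero_add, SuperGeom.chartLaplacian_apply] at hij
      exact (smul_eq_zero.1 hij.symm).resolve_left two_ne_zero
  · intro h
    refine ⟨fun a f g hf => ?_, fun f => M.ext_toLoc fun c => ?_⟩
    -- Generation of the bracket holds without the two equations.
    · rw [hΔ.map_mul hB hf g, add_assoc, add_sub_cancel_left, add_sub_cancel_left,
        SuperGeom.sgn_smul_sgn_smul]
    · have hT : ∀ i, SuperGeom.chartLaplacian P S c (SuperGeom.Tvec P S c i) = 0 := fun i =>
        (SuperGeom.chartLaplacian_apply P S c _).trans ((h c).1 i)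
      -- The first equation gives the vanishing of the square on coordinates, both together on
      -- products of two; `hPoisson` bounds its order.
      have hE : SuperGeom.chartLaplacian P S c * SuperGeom.chartLaplacian P S c = 0 := by
        have hm := (M.chart c).coords.lap_mem_diffOps (M.isSuperalgebra _) (S.comp c)
          (SuperGeom.Tvec P S c)
        refine (M.chart c).coords.secondOrder_eq_zero (M.isSuperalgebra _) (mul_mem hm hm)
          (fun b f hf => ?_) ?_ (fun i => ?_) (fun i j => ?_) fun i j z => ?_
        · have hf' := SuperGeom.chartLaplacian_mem P S c (SuperGeom.chartLaplacian_mem P S c hf)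
          rwa [add_assoc, SuperGeom.zmod_two_one_add_one, add_zero] at hf'
        · rw [Module.End.mul_apply, SuperGeom.chartLaplacian, SuperGeom.SuperCoords.lap_one _
            (M.isSuperalgebra _), map_zero]
        · rw [Module.End.mul_apply, hC, hT]
        · rw [Module.End.mul_apply, SuperGeom.chartLaplacian_sq_x_mul_x, hT, hT, zero_mul,
            mul_zero, zero_add, zero_add, SuperGeom.chartLaplacian_apply]
          exact smul_eq_zero_of_right _ ((h c).2 i j)
        · exact SuperGeom.chartLaplacian_sq_secondOrder hΔ hB hPoisson c
            ((M.chart c).coords.x_mem i) ((M.chart c).coords.x_mem j) z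
      rw [hΔ.sq_toLoc, map_zero]
      exact LinearMap.congr_fun hE _
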